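/- Let $1<p\le 2$ and $\frac1p+\frac1{p'}=1$. Write $\mathbb{C}_+=\{s:\operatorname{Re}s>0\}$, let $\mathcal{L}(\phi)(s)=\int_0^\infty e^{-st}\phi(t)\,dt$ be the Laplace transform on $L^{p'}(0,\infty)$, and let $H^p(\mathbb{C}_+)$ be the Hardy space of analytic functions $\Phi$ on $\mathbb{C}_+$ with $\sup_{x>0}\frac1{2\pi}\int_{\mathbb{R}}|\Phi(x+iy)|^p\,dy<\infty$. Let $f\not\equiv 0$ be analytic on $\mathbb{C}_+$ and let $J\in L^{p'}(0,\infty)$ be such that $\mathcal{L}(J)\in H^p(\mathbb{C}_+)$ and $\mathcal{L}(J)/f\in H^p(\mathbb{C}_+)$ (quotients by $f$ are understood after removing removable singularities). Let $N\ge 0$, let $r_1,\dots,r_N$ be positive integers, put $K=\sum_i r_i$, and assume that for some $\sigma>0$ the functions $y\mapsto y^n\,\frac{\mathcal{L}(J)}{f}(\sigma+iy)$, $n=0,\dots,K$, belong to $L^1(\mathbb{R})$. For $\omega=(\omega_1,\dots,\omega_N)$ with $\operatorname{Re}\omega_i<0$ and $c=(\phi_0,\dots,\phi_{K-1})\in\mathbb{C}^K$,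 a solution of the classical initial value problem $$f(\partial_t)\phi=J,\qquad \phi^{(n)}(0)=\phi_n\quad(0\le n\le K-1)$$ is a pair $(\phi,r_0)$ with $\phi\in L^{p'}(0,\infty)$ and $r_0$ analytic on $\mathbb{C}_+$ such that - $f\mathcal{L}(\phi)-r_0\in H^p(\mathbb{C}_+)$ and $\mathcal{L}^{-1}(f\mathcal{L}(\phi)-r_0)=J$; - $\phi$ has a representative which is $C^K$ on some $[0,\varepsilon)$ and whose one-sided derivatives at $0$ satisfy $\phi^{(n)}(0)=\phi_n$ for $0\le n\le K-1$; - $r_0/f\in H^p(\mathbb{C}_+)$, and $r_0/f$ has a meromorphic continuation to $\mathbb{C}$ whose only possible poles are the $\omega_i$, of order at most $r_i$, and which is bounded by $C/|s|^q$, for some $C$ and some $q\ge1$, for $|s|$ sufficiently large; - $(\mathcal{L}(J)+r_0)/f\in H^p(\mathbb{C}_+)$. Let $A(\omega)$ be the $K\times K$ matrix with rows $n=0,\dots,K-1$, columns $(i,j)$ with $1\le i\le N$, $0\le j<r_i$, and entries $\binom nj\omega_i^{\,n-j}$ (zero for $j>n$). Then $\det A(\omega)$ is a nonzero polynomial in $\omega$,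 and for every $\omega$ with all $\operatorname{Re}\omega_i<0$ and $\det A(\omega)\neq0$ the following hold. 1. For every $c\in\mathbb{C}^K$ the problem has a solution $(\phi_c,r_{0,c})$, and it is unique (as a pair consisting of an element of $L^{p'}(0,\infty)$ and a function on $\mathbb{C}_+$). 2. There is a nonzero polynomial $P$ on $\mathbb{C}^K$ such that, whenever $P(c)\neq0$, the poles $\omega_i$ of $r_{0,c}/f$ have order exactly $r_i$. 3. $\phi_c$ has a representative $u_c$ of class $C^K$ on $[0,\infty)$, and $u_c^{(n)}(0)=\phi_n$ for $0\le n\le K-1$. 4. The solution depends smoothly on the initial conditions: $c\mapsto\phi_c\in L^{p'}(0,\infty)$ is $C^\infty$; for all $t\ge0$ and $0\le n\le K$ the map $c\mapsto u_c^{(n)}(t)$ is $C^\infty$; and for all $s\in\mathbb{C}_+$ the map $c\mapsto r_{0,c}(s)$ is $C^\infty$. -/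

import Mathlib

open MeasureTheory Set Filter Topology
open scoped ENNReal NNReal ContDiff

namespace NonlocalIVP

noncomputable section

/-- The open right half-plane `ℂ₊`. -/
def rightHalfPlane : Set ℂ := {s : ℂ | 0 < s.re}

/-- The Lebesgue space `L^q(0,∞)` of complex-valued functions (classes modulo null sets). -/
abbrev LpHalfLine (q : ℝ≥0∞) : Type :=
  Lp ℂ q ((volume : Measure ℝ).restrict (Ioi 0))

/-- The Laplace transform `s ↦ ∫₀^∞ e^{-st} φ(t) dt`. -/
def laplace (φ : ℝ → ℂ) (s : ℂ) : ℂ :=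
  ∫ t in Ioi (0 : ℝ), Complex.exp (-(s * (t : ℂ))) * φ t

/-- The mean `μ_q(Φ, x) = ((1/2π) ∫ |Φ(x+iy)|^q dy)^{1/q}` on the vertical line `Re s = x`. -/
def hardyMean (q : ℝ≥0∞) (Φ : ℂ → ℂ) (x : ℝ) : ℝ≥0∞ :=
  eLpNorm (fun y : ℝ => Φ ((x : ℂ) + (y : ℂ) * Complex.I)) q
    (ENNReal.ofReal (1 / (2 * Real.pi)) • (volume : Measure ℝ))

/-- Membership in the Hardy space `H^q(ℂ₊)`: `Φ` is analytic on `ℂ₊` and `μ_q(Φ, x)` is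
uniformly bounded for `x > 0`. -/
def MemHardy (q : ℝ≥0∞) (Φ : ℂ → ℂ) : Prop :=
  DifferentiableOn ℂ Φ rightHalfPlane ∧
    ∃ C : ℝ≥0, ∀ x : ℝ, 0 < x → hardyMean q Φ x ≤ C

/-- `G` is the quotient `g / f` on `ℂ₊`. Written multiplicatively, so that for a continuous `G` and
an analytic `f ≢ 0` the removable singularities at the zeros of `f` are removed. -/
def IsQuotient (g f G : ℂ → ℂ) : Prop :=
  ∀ s ∈ rightHalfPlane, g s = f s * G s

/-- `φ ∈ L^q(0,∞)` is the inverse Laplace transform of `Φ` (a function on `ℂ₊`). -/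
def IsInverseLaplace {q : ℝ≥0∞} (Φ : ℂ → ℂ) (φ : LpHalfLine q) : Prop :=
  ∀ s ∈ rightHalfPlane, laplace φ s = Φ s

/-- The pair `(φ, r)` lies in the domain `D_f` of `f(∂_t)`: `f L(φ) - r` belongs to `H^p(ℂ₊)`. -/
def MemDomain (p : ℝ≥0∞) {p' : ℝ≥0∞} (f : ℂ → ℂ) (φ : LpHalfLine p') (r : ℂ → ℂ) : Prop :=
  DifferentiableOn ℂ r rightHalfPlane ∧ MemHardy p (fun s => f s * laplace φ s - r s)

/-- `φ` solves `f(∂_t)(φ, r) = J`, where `f(∂_t)(φ, r) = L⁻¹(f L(φ) - r)` for `(φ, r) ∈ D_f`. -/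
def SolvesEquation (p : ℝ≥0∞) {p' : ℝ≥0∞} (f : ℂ → ℂ) (J φ : LpHalfLine p') (r : ℂ → ℂ) : Prop :=
  MemDomain p f φ r ∧ IsInverseLaplace (fun s => f s * laplace φ s - r s) J

/-- `φ^{(n)}(0) = c n` for `n < K` (one-sided derivatives), where `φ ∈ L^q(0,∞)` has a
representative which is `K` times continuously differentiable on some `[0, ε)`. -/
def HasInitialData {q : ℝ≥0∞} {K : ℕ} (φ : LpHalfLine q) (c : Fin K → ℂ) : Prop :=
  ∃ g : ℝ → ℂ, φ =ᵐ[(volume : Measure ℝ).restrict (Ioi 0)] g ∧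
    ContDiffWithinAt ℝ K g (Ici 0) 0 ∧
    ∀ n : Fin K, iteratedDerivWithin n g (Ici 0) 0 = c n

/-- `R` is a meromorphic continuation to all of `ℂ` of the quotient `r₀ / f` given on `ℂ₊`, with no
singularity outside `{w₁, …, w_N}`. -/
def IsContinuedQuotient {N : ℕ} (w : Fin N → ℂ) (r₀ f R : ℂ → ℂ) : Prop :=
  IsQuotient r₀ f R ∧ DifferentiableOn ℂ R (range w)ᶜ ∧ ∀ i, MeromorphicAt R (w i)

/-- `|R(s)| ≤ C / |s|^q` for some `q ≥ 1` and `|s|` sufficiently large. -/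
def DecaysAtInfinity (R : ℂ → ℂ) : Prop :=
  ∃ q : ℝ, 1 ≤ q ∧ ∃ C : ℝ, ∃ B : ℝ, ∀ s : ℂ, B ≤ ‖s‖ → ‖R s‖ ≤ C / ‖s‖ ^ q

/-- `(φ, r₀)` solves the classical initial value problem `f(∂_t) φ = J`, `φ^{(n)}(0) = c n` for
`n < K = r₁ + ⋯ + r_N`, with pole data `w₁, …, w_N` of orders `r₁, …, r_N`. -/
structure IsClassicalSolution (p : ℝ≥0∞) {p' : ℝ≥0∞} (f : ℂ → ℂ) (J : LpHalfLine p') {N : ℕ}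
    (w : Fin N → ℂ) (r : Fin N → ℕ) (c : Fin (∑ i, r i) → ℂ)
    (φ : LpHalfLine p') (r₀ : ℂ → ℂ) : Prop where
  solves : SolvesEquation p f J φ r₀
  initial : HasInitialData φ c
  /-- `r₀ / f` is in `H^p(ℂ₊)`, its only possible poles are the `w i`, of order at most `r i`, and
  it decays at infinity. -/
  poles : ∃ R : ℂ → ℂ, IsContinuedQuotient w r₀ f R ∧ MemHardy p R ∧
    (∀ i, ((-(r i : ℤ) : ℤ) : WithTop ℤ) ≤ meromorphicOrderAt R (w i)) ∧ DecaysAtInfinity R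
  /-- `(L(J) + r₀) / f` is in `H^p(ℂ₊)`. -/
  total : ∃ H : ℂ → ℂ, IsQuotient (fun s => laplace J s + r₀ s) f H ∧ MemHardy p H

/-- The matrix of the linear system
`c n = L_n + (d/dt)^n|_{t=0} ∑ᵢ P_i(t) e^{w_i t}`, `n < K`, where
`P_i(t) = ∑_{j < r i} a_{i,j} t^j / j!`, in the unknowns `a_{i,j}`: the coefficient of `a_{i,j}`
in row `n` is `(n choose j) w_i^{n-j}` (zero for `j > n`). -/
def initialMatrix {N : ℕ} (r : Fin N → ℕ) (w : Fin N → ℂ) :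
    Matrix (Fin (∑ i, r i)) (Fin (∑ i, r i)) ℂ :=
  Matrix.of fun n k =>
    let ij : (i : Fin N) × Fin (r i) := finSigmaFinEquiv.symm k
    ((n : ℕ).choose (ij.2 : ℕ) : ℂ) * w ij.1 ^ ((n : ℕ) - (ij.2 : ℕ))

end

end NonlocalIVP

/-! ### Plancherel's theorem for integrable square-integrable functions -/

namespace NonlocalIVP

open FourierTransform SchwartzMap

/-! Put `G = L(J)/f` and `R = r₀/f`. Dividing the equation by `f` gives `L(φ) = G + R`. The function
`R` continues to the plane with poles only at the `w i`, of order at most `r i`, and tends to zero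
at infinity. After its principal parts are subtracted, Liouville's theorem leaves nothing
(`exists_eq_rationalPart`), so `R = ∑ a i j / (s - w i)^(j+1)` and `φ = g + ∑ a i j t^j/j! e^{w i
t}`, where `g` is the inverse Laplace transform of `G`.

The function `g` is `C^K` on the whole line and vanishes for `t < 0`, so its derivatives up to order
`K` vanish at `0`. The initial conditions therefore become the linear system `A a = c`. Its matrix
is a confluent Vandermonde matrix, invertible exactly when the `w i` are distinct. Hence `a = A⁻¹ c`
exists, is unique, and is linear in `c`, which gives smooth dependence. A pole has exact order `r i`
as soon as its top coefficient, a nonzero linear form in `c`, does not vanish.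

The analytic work lies in two facts about the Laplace transform. The first is that `g` lies in
`L^{p'}`, vanishes on the negative half-line and satisfies `L(g) = G` (`bromwich_properties`).
Multiplying `G` by `(1 + ε s)⁻²` puts it in `H^1`, where contour shifts and Fourier inversion are
available; a Hausdorff–Young estimate bounds the `L^{p'}` norms uniformly, and Fatou's lemma gives
the limit `ε → 0`. The second is injectivity on `L^{p'}(0,∞)`, `p' ≥ 2` (`ae_eq_of_laplace_eq`),
which follows from Plancherel after damping by `e^{-t}`. -/

theorem continuous_fourier_of_integrable {f : ℝ → ℂ} (hf : Integrable f) :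
    Continuous (𝓕 f) :=
  VectorFourier.fourierIntegral_continuous Real.continuous_fourierChar
    (by exact continuous_inner) hf

theorem norm_fourier_le_integral (f : ℝ → ℂ) (t : ℝ) : ‖𝓕 f t‖ ≤ ∫ y, ‖f y‖ :=
  VectorFourier.norm_fourierIntegral_le_integral_norm Real.fourierChar _ (innerₗ ℝ) f t

/-- The Fourier integral of a function in `L¹ ∩ L²` agrees with its `L²` Fourier transform. -/
theorem fourier_ae_eq_fourier_toLp {f : ℝ → ℂ} (h1 : Integrable f) (h2 : MemLp f 2 volume) :
    (𝓕 f) =ᵐ[volume] (𝓕 (h2.toLp f) : Lp ℂ 2 (volume : Measure ℝ)) := by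
  apply ae_eq_of_integral_contDiff_smul_eq
  · exact (continuous_fourier_of_integrable h1).locallyIntegrable
  · exact (Lp.memLp _).locallyIntegrable (by norm_num)
  · intro g g_smooth g_cpt
    have hg₁ : HasCompactSupport (Complex.ofRealCLM ∘ g) := g_cpt.comp_left rfl
    have hg₂ : ContDiff ℝ ∞ (Complex.ofRealCLM ∘ g) := by fun_prop
    set ψ : 𝓢(ℝ, ℂ) := hg₁.toSchwartzMap hg₂ with hψ
    have hψg : ∀ x, ψ x = (g x : ℂ) := fun x => rfl
    -- The `L²` transform is determined as a tempered distribution by duality. The `L¹` transform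
    -- satisfies the same duality with `ψ`, so the two agree against every test function.
    have key := congrArg (fun T => T ψ) (Lp.fourier_toTemperedDistribution_eq (h2.toLp f))
    simp only [TemperedDistribution.fourier_apply, Lp.toTemperedDistribution_apply] at key
    have e2 : ∀ u : ℝ → ℂ, ∫ x, g x • u x = ∫ x, ψ x • u x := fun u => by
      refine integral_congr_ae (ae_of_all _ fun x => ?_)
      simp [hψg]
    rw [e2, e2, ← key]
    have e3 : ∫ x, (𝓕 ψ) x • (h2.toLp f : ℝ → ℂ) x = ∫ x, (𝓕 ψ) x • f x := by
      refine integral_congr_ae ?_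
      filter_upwards [h2.coeFn_toLp] with x hx
      rw [hx]
    rw [e3]
    have := VectorFourier.integral_fourierIntegral_smul_eq_flip (L := innerₗ ℝ)
      (μ := volume) (ν := volume)
      Real.continuous_fourierChar (by exact continuous_inner) ψ.integrable h1
    rw [flip_innerₗ] at this
    exact this.symm

/-- Plancherel's theorem on `L¹ ∩ L²`. -/
theorem eLpNorm_fourier_two {f : ℝ → ℂ} (h1 : Integrable f) (h2 : MemLp f 2 volume) :
    eLpNorm (𝓕 f) 2 volume = eLpNorm f 2 volume := by
  rw [eLpNorm_congr_ae (fourier_ae_eq_fourier_toLp h1 h2)]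
  have h := Lp.norm_fourier_eq (h2.toLp f)
  rw [Lp.norm_def, Lp.norm_toLp, ENNReal.toReal_eq_toReal_iff' (Lp.eLpNorm_ne_top _)
    h2.eLpNorm_ne_top] at h
  exact h

end NonlocalIVP

/-! ### A Hausdorff–Young estimate by real interpolation -/

namespace NonlocalIVP

open FourierTransform

theorem fourier_add_of_integrable {f g : ℝ → ℂ} (hf : Integrable f) (hg : Integrable g) :
    𝓕 (fun x => f x + g x) = fun t => 𝓕 f t + 𝓕 g t :=
  VectorFourier.fourierIntegral_add (L := innerₗ ℝ) Real.continuous_fourierChar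
    (by exact continuous_inner) hf hg

/-- The distribution function of the Fourier transform, estimated by splitting the function at
the height where `l * ‖F‖ ^ (p - 1) = 2 * A`. -/
theorem volume_lt_norm_fourier_le {F : ℝ → ℂ} (hF : StronglyMeasurable F) (h1 : Integrable F)
    {p A l : ℝ} (hp : 1 < p) (hA : 0 < A) (hl : 0 < l)
    (hFA : ∫⁻ x, ENNReal.ofReal (‖F x‖ ^ p) ≤ ENNReal.ofReal A) :
    volume {t | l < ‖𝓕 F t‖} ≤ ENNReal.ofReal (4 / l ^ 2) *
      ∫⁻ x in {x | l * ‖F x‖ ^ (p - 1) ≤ 2 * A}, ENNReal.ofReal (‖F x‖ ^ 2) := by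
  set S : Set ℝ := {x | l * ‖F x‖ ^ (p - 1) ≤ 2 * A} with hS
  have hSm : MeasurableSet S :=
    measurableSet_le ((hF.norm.measurable.pow_const _).const_mul l) measurable_const
  set F1 : ℝ → ℂ := Sᶜ.indicator F
  set F2 : ℝ → ℂ := S.indicator F
  have hF1 : Integrable F1 := h1.indicator hSm.compl
  have hF2 : Integrable F2 := h1.indicator hSm
  have hsum : 𝓕 F = fun t => 𝓕 F1 t + 𝓕 F2 t := by
    rw [← fourier_add_of_integrable hF1 hF2]
    congr 1
    ext x
    exact (indicator_compl_add_self_apply S F x).symm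
  -- Off `S` one has `‖F‖ ≤ (l / 2A) ‖F‖ ^ p`, so the large part contributes at most half of the
  -- level `l` to the transform, at every point.
  have hb1 : ∫ y, ‖F1 y‖ ≤ l / 2 := by
    rw [integral_eq_lintegral_of_nonneg_ae (ae_of_all _ fun _ => norm_nonneg _)
      hF1.norm.aestronglyMeasurable]
    refine ENNReal.toReal_le_of_le_ofReal (by positivity) ?_
    calc ∫⁻ y, ENNReal.ofReal ‖F1 y‖
        ≤ ∫⁻ y, ENNReal.ofReal (l / (2 * A)) * ENNReal.ofReal (‖F y‖ ^ p) := by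
          refine lintegral_mono fun y => ?_
          by_cases hy : y ∈ S
          · simp [F1, hy]
          · have hy' : 2 * A < l * ‖F y‖ ^ (p - 1) := not_le.1 hy
            have hpos : 0 < ‖F y‖ := by
              by_contra h0
              have : ‖F y‖ = 0 := le_antisymm (not_lt.1 h0) (norm_nonneg _)
              rw [this, Real.zero_rpow (by linarith)] at hy'
              linarith
            rw [← ENNReal.ofReal_mul (by positivity)]
            refine ENNReal.ofReal_le_ofReal ?_
            have hn : ‖F1 y‖ = ‖F y‖ := by simp [F1, hy]
            have hpw : ‖F y‖ ^ p = ‖F y‖ ^ (p - 1) * ‖F y‖ := by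
              rw [← Real.rpow_add_one hpos.ne', sub_add_cancel]
            rw [hn, hpw, ← mul_assoc]
            refine le_mul_of_one_le_left hpos.le ?_
            rw [div_mul_eq_mul_div, one_le_div (by positivity)]
            exact hy'.le
      _ = ENNReal.ofReal (l / (2 * A)) * ∫⁻ y, ENNReal.ofReal (‖F y‖ ^ p) :=
          lintegral_const_mul' _ _ ENNReal.ofReal_ne_top
      _ ≤ ENNReal.ofReal (l / (2 * A)) * ENNReal.ofReal A := by gcongr
      _ = ENNReal.ofReal (l / 2) := by
          rw [← ENNReal.ofReal_mul (by positivity)]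
          congr 1
          field_simp
  -- The small part must supply the other half; Chebyshev's inequality and Plancherel then apply to
  -- it. If it is not in `L²`, the right-hand side is infinite.
  have hsub : {t | l < ‖𝓕 F t‖} ⊆ {t | ENNReal.ofReal (l / 2) ≤ ‖𝓕 F2 t‖ₑ} := by
    intro t ht
    rw [mem_ofPred_eq, hsum] at ht
    have h1 := (norm_add_le (𝓕 F1 t) (𝓕 F2 t))
    have h2 := (norm_fourier_le_integral F1 t).trans hb1
    rw [mem_ofPred_eq, ← ofReal_norm]
    exact ENNReal.ofReal_le_ofReal (by simp only at ht; linarith)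
  have hsq : eLpNorm F2 2 volume ^ (2 : ℝ) = ∫⁻ x in S, ENNReal.ofReal (‖F x‖ ^ 2) := by
    rw [eLpNorm_eq_lintegral_rpow_enorm_toReal (by norm_num) (by norm_num), ← ENNReal.rpow_mul]
    simp only [ENNReal.toReal_ofNat]
    norm_num
    rw [← lintegral_indicator hSm]
    refine lintegral_congr fun x => ?_
    by_cases hx : x ∈ S
    · simp [F2, hx]
    · simp [F2, hx]
  rw [← hsq]
  by_cases hm : MemLp F2 2 volume
  · refine (measure_mono hsub).trans ?_
    refine (meas_ge_le_mul_pow_eLpNorm_enorm volume (p := 2) (by norm_num) (by norm_num)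
      (continuous_fourier_of_integrable hF2).aestronglyMeasurable
      (by simpa using hl) (by simp)).trans ?_
    rw [eLpNorm_fourier_two hF2 hm, ENNReal.toReal_ofNat]
    gcongr
    rw [← ENNReal.ofReal_inv_of_pos (by positivity), ENNReal.ofReal_rpow_of_pos (by positivity)]
    refine ENNReal.ofReal_le_ofReal (le_of_eq ?_)
    norm_num
    ring
  · have : eLpNorm F2 2 volume = ⊤ := by
      by_contra h
      exact hm ⟨hF2.aestronglyMeasurable, lt_top_iff_ne_top.2 h⟩
    rw [this, ENNReal.top_rpow_of_pos (by norm_num), ENNReal.mul_top]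
    · exact le_top
    · simp; positivity

/-- This is the integral over levels that remains, at a point where `‖F‖ = m`, after exchanging the
order of integration in the layer-cake formula. The cutoff is `l ≤ 2A / m^(p-1)`, and `l^(q-3)` is
integrable at `0` because `q > 2`. Conjugacy gives `(p-1)(q-2) = 2 - p`, which turns `m^2` into
`m^p`. -/
theorem lintegral_truncated_rpow_le {p q A m : ℝ} (hq : 2 < q)
    (hpq : p.HolderConjugate q) (hA : 0 < A) (hm : 0 ≤ m) :
    ∫⁻ l in Ioi (0 : ℝ), {l : ℝ | l * m ^ (p - 1) ≤ 2 * A}.indicator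
      (fun l => ENNReal.ofReal (m ^ 2) * ENNReal.ofReal (4 * l ^ (q - 3))) l
    ≤ ENNReal.ofReal (4 * (2 * A) ^ (q - 2) / (q - 2)) * ENNReal.ofReal (m ^ p) := by
  rcases hm.eq_or_lt with rfl | hm
  · simp
  have hmp : 0 < m ^ (p - 1) := Real.rpow_pos_of_pos hm _
  set L : ℝ := 2 * A / m ^ (p - 1) with hL
  have hLpos : 0 < L := by positivity
  have hset : {l : ℝ | l * m ^ (p - 1) ≤ 2 * A} = Iic L := by
    ext l
    simp [hL, le_div_iff₀ hmp]
  rw [hset, lintegral_indicator measurableSet_Iic, Measure.restrict_restrict measurableSet_Iic,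
    inter_comm, Ioi_inter_Iic, lintegral_const_mul' _ _ ENNReal.ofReal_ne_top]
  have hint : IntegrableOn (fun l : ℝ => 4 * l ^ (q - 3)) (Ioc 0 L) := by
    have := (intervalIntegral.intervalIntegrable_rpow' (a := 0) (b := L)
      (r := q - 3) (by linarith)).const_mul 4
    rwa [intervalIntegrable_iff_integrableOn_Ioc_of_le hLpos.le] at this
  rw [← ofReal_integral_eq_lintegral_ofReal hint
    ((ae_restrict_iff' measurableSet_Ioc).2 (ae_of_all _ fun l hl =>
      mul_nonneg (by norm_num) (Real.rpow_nonneg hl.1.le _))),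
    ← intervalIntegral.integral_of_le hLpos.le, intervalIntegral.integral_const_mul,
    integral_rpow (Or.inl (by linarith)), ← ENNReal.ofReal_mul (by positivity),
    ← ENNReal.ofReal_mul (div_nonneg (by positivity) (by linarith))]
  refine ENNReal.ofReal_le_ofReal (le_of_eq ?_)
  rw [show q - 3 + 1 = q - 2 by ring, Real.zero_rpow (by linarith), sub_zero, hL,
    Real.div_rpow (by positivity) hmp.le, ← Real.rpow_mul hm.le]
  have h2 : m ^ 2 = m ^ p * m ^ ((p - 1) * (q - 2)) := by
    rw [← Real.rpow_add hm, ← Real.rpow_natCast]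
    congr 1
    have := hpq.mul_eq_add
    push_cast
    linarith
  rw [h2]
  have : m ^ ((p - 1) * (q - 2)) ≠ 0 := (Real.rpow_pos_of_pos hm _).ne'
  have : q - 2 ≠ 0 := by linarith
  field_simp

/-- A Hausdorff–Young estimate, with a non-sharp constant, for `1 < p < 2`. -/
theorem lintegral_norm_fourier_rpow_le {F : ℝ → ℂ} (hF : StronglyMeasurable F)
    (h1 : Integrable F) {p q A : ℝ} (hp : 1 < p) (hq : 2 < q) (hpq : p.HolderConjugate q)
    (hA : 0 < A) (hFA : ∫⁻ x, ENNReal.ofReal (‖F x‖ ^ p) ≤ ENNReal.ofReal A) :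
    ∫⁻ t, ENNReal.ofReal (‖𝓕 F t‖ ^ q) ≤
      ENNReal.ofReal q * (ENNReal.ofReal (4 * (2 * A) ^ (q - 2) / (q - 2)) * ENNReal.ofReal A) := by
  rw [lintegral_rpow_eq_lintegral_meas_lt_mul volume (ae_of_all _ fun _ => norm_nonneg _)
    (continuous_fourier_of_integrable h1).norm.aemeasurable (by linarith)]
  gcongr
  set S : Set (ℝ × ℝ) := {z | z.1 * ‖F z.2‖ ^ (p - 1) ≤ 2 * A}
  have hn : Measurable fun x => ‖F x‖ := hF.norm.measurable
  have hSm : MeasurableSet S := by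
    have : Measurable fun z : ℝ × ℝ => z.1 * ‖F z.2‖ ^ (p - 1) :=
      measurable_fst.mul ((hn.comp measurable_snd).pow_const _)
    exact measurableSet_le this measurable_const
  set k : ℝ × ℝ → ℝ≥0∞ := fun z =>
    ENNReal.ofReal (‖F z.2‖ ^ 2) * ENNReal.ofReal (4 * z.1 ^ (q - 3))
  have hk : Measurable k := by
    have h2 : Measurable fun z : ℝ × ℝ => ENNReal.ofReal (‖F z.2‖ ^ 2) :=
      ((hn.comp measurable_snd).pow_const 2).ennreal_ofReal
    have h3 : Measurable fun z : ℝ × ℝ => ENNReal.ofReal (4 * z.1 ^ (q - 3)) :=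
      ((measurable_fst.pow_const _).const_mul 4).ennreal_ofReal
    exact h2.mul h3
  calc ∫⁻ l in Ioi 0, volume {t | l < ‖𝓕 F t‖} * ENNReal.ofReal (l ^ (q - 1))
      ≤ ∫⁻ l in Ioi 0, ∫⁻ x, S.indicator k (l, x) := by
        refine setLIntegral_mono' measurableSet_Ioi fun l hl => ?_
        have hl : 0 < l := hl
        refine (mul_le_mul_left (volume_lt_norm_fourier_le hF h1 hp hA hl hFA) _).trans ?_
        rw [mul_right_comm, ← ENNReal.ofReal_mul (by positivity),
          show 4 / l ^ 2 * l ^ (q - 1) = 4 * l ^ (q - 3) by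
            rw [show q - 1 = q - 3 + 2 by ring, Real.rpow_add hl]
            norm_num
            field_simp,
          ← lintegral_const_mul' _ _ ENNReal.ofReal_ne_top,
          ← lintegral_indicator (measurableSet_le ((hn.pow_const _).const_mul l)
            measurable_const)]
        refine lintegral_mono fun x => le_of_eq ?_
        simp only [indicator, S, k, mem_ofPred_eq, mul_comm]
    _ = ∫⁻ x, ∫⁻ l in Ioi 0, S.indicator k (l, x) :=
        lintegral_lintegral_swap (hk.indicator hSm).aemeasurable
    _ ≤ ∫⁻ x, ENNReal.ofReal (4 * (2 * A) ^ (q - 2) / (q - 2)) * ENNReal.ofReal (‖F x‖ ^ p) :=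
        lintegral_mono fun x =>
          lintegral_truncated_rpow_le (m := ‖F x‖) hq hpq hA (norm_nonneg _)
    _ ≤ _ := by
        rw [lintegral_const_mul' _ _ ENNReal.ofReal_ne_top]
        gcongr

/-- The Fourier transform maps bounded subsets of `L^p`, consisting of integrable functions, to
bounded subsets of `L^{p'}`. -/
theorem exists_eLpNorm_fourier_le {p q : ℝ≥0∞} (hp : 1 < p) (hp2 : p ≤ 2)
    (hpq : 1 / p + 1 / q = 1) (M : ℝ≥0) :
    ∃ C : ℝ≥0, ∀ F : ℝ → ℂ, Integrable F → eLpNorm F p volume ≤ M → eLpNorm (𝓕 F) q volume ≤ C := by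
  have hpt : p ≠ ⊤ := (hp2.trans_lt (by norm_num)).ne
  have hp0 : p ≠ 0 := (zero_lt_one.trans hp).ne'
  -- The exponent `p = 2` is Plancherel; the layer-cake argument needs `q > 2`.
  rcases hp2.eq_or_lt with rfl | hp2
  · have hq : q = 2 := by
      have h2 : (1 : ℝ≥0∞) / 2 + 1 / q = 1 / 2 + 1 / 2 := by rw [hpq, ENNReal.add_halves]
      have := (ENNReal.add_right_inj (by norm_num)).1 h2
      simpa using this
    subst hq
    exact ⟨M, fun F hF hM => (eLpNorm_fourier_two hF
      ⟨hF.aestronglyMeasurable, hM.trans_lt ENNReal.coe_lt_top⟩).trans_le hM⟩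
  have hq0 : q ≠ 0 := by
    rintro rfl
    simp at hpq
  have hqt : q ≠ ⊤ := by
    rintro rfl
    simp at hpq
    exact hp.ne' hpq
  set p₁ := p.toReal
  set q₁ := q.toReal
  have hp1 : 1 < p₁ := by
    have := (ENNReal.toReal_lt_toReal ENNReal.one_ne_top hpt).2 hp
    simpa using this
  have hp12 : p₁ < 2 := by
    have := (ENNReal.toReal_lt_toReal hpt (by norm_num : (2 : ℝ≥0∞) ≠ ⊤)).2 hp2
    simpa using this
  have hconj : p₁.HolderConjugate q₁ := by
    rw [Real.holderConjugate_iff]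
    refine ⟨hp1, ?_⟩
    have := congrArg ENNReal.toReal hpq
    rw [ENNReal.toReal_add (by simp [hp0]) (by simp [hq0])] at this
    simpa using this
  have hq2 : 2 < q₁ := by
    have := hconj.mul_eq_add
    have : (p₁ - 1) * (q₁ - 1) = 1 := by linarith
    by_contra h
    nlinarith
  -- The summand `1` keeps `A` positive when `M = 0`.
  set A : ℝ := (M : ℝ) ^ p₁ + 1 with hAdef
  have hA : 0 < A := by positivity
  set B : ℝ≥0∞ := ENNReal.ofReal q₁ *
    (ENNReal.ofReal (4 * (2 * A) ^ (q₁ - 2) / (q₁ - 2)) * ENNReal.ofReal A) with hB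
  have hBt : B ≠ ⊤ := by
    rw [hB]; finiteness
  refine ⟨(B ^ (1 / q₁)).toNNReal, fun F hF hM => ?_⟩
  rw [ENNReal.coe_toNNReal (ENNReal.rpow_ne_top_of_nonneg (by positivity) hBt)]
  obtain ⟨F', hF', hFF'⟩ := hF.aestronglyMeasurable
  have hfour : 𝓕 F = 𝓕 F' := by
    ext t
    simp only [Real.fourier_eq]
    refine integral_congr_ae ?_
    filter_upwards [hFF'] with x hx
    rw [hx]
  rw [eLpNorm_congr_ae hFF'] at hM
  rw [hfour, eLpNorm_eq_lintegral_rpow_enorm_toReal hq0 hqt]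
  rw [eLpNorm_eq_lintegral_rpow_enorm_toReal hp0 hpt] at hM
  refine ENNReal.rpow_le_rpow ?_ (by positivity)
  have hen : ∀ (z : ℂ) (r : ℝ), 0 ≤ r → ‖z‖ₑ ^ r = ENNReal.ofReal (‖z‖ ^ r) := fun z r hr => by
    rw [← ofReal_norm, ENNReal.ofReal_rpow_of_nonneg (norm_nonneg _) hr]
  have hFA : ∫⁻ x, ENNReal.ofReal (‖F' x‖ ^ p₁) ≤ ENNReal.ofReal A := by
    have h := ENNReal.rpow_le_rpow hM (by positivity : 0 ≤ p₁)
    rw [← ENNReal.rpow_mul, one_div_mul_cancel (by positivity), ENNReal.rpow_one] at h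
    simp only [hen _ p.toReal ENNReal.toReal_nonneg] at h
    refine h.trans ?_
    rw [← ENNReal.ofReal_coe_nnreal, ENNReal.ofReal_rpow_of_nonneg M.coe_nonneg (by positivity)]
    exact ENNReal.ofReal_le_ofReal (by rw [hAdef]; linarith)
  simp only [hen _ q.toReal ENNReal.toReal_nonneg]
  exact lintegral_norm_fourier_rpow_le hF' (hF.congr hFF') hp1 hq2 hconj hA hFA

end NonlocalIVP

/-! ### The Bromwich integral of an `H^1` function -/

namespace NonlocalIVP

open FourierTransform

noncomputable section

/-- The restriction of `Φ` to the vertical line `Re s = x`, in the normalisation of the Fourier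
transform. -/
def verticalLine (Φ : ℂ → ℂ) (x : ℝ) : ℝ → ℂ :=
  fun y => Φ ((x : ℂ) + ((2 * Real.pi * y : ℝ) : ℂ) * Complex.I)

/-- The inverse Laplace transform of `Φ`, computed on the line `Re s = x`. -/
def bromwich (Φ : ℂ → ℂ) (x t : ℝ) : ℂ :=
  Complex.exp ((x * t : ℝ) : ℂ) * 𝓕⁻ (verticalLine Φ x) t

/-- The substitution `y ↦ 2πy` absorbs the factor `1/(2π)` of the Hardy mean. -/
theorem hardyMean_eq_eLpNorm_verticalLine (q : ℝ≥0∞) (Φ : ℂ → ℂ) (x : ℝ) :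
    hardyMean q Φ x = eLpNorm (verticalLine Φ x) q volume := by
  have h2 : (2 * Real.pi) ≠ 0 := by positivity
  have hm := Real.map_volume_mul_left h2
  have he : MeasurableEmbedding fun y : ℝ => 2 * Real.pi * y :=
    (Homeomorph.mulLeft₀ _ h2).measurableEmbedding
  rw [hardyMean, show (1 / (2 * Real.pi)) = |(2 * Real.pi)⁻¹| by
    rw [abs_of_pos (by positivity), one_div], ← hm, he.eLpNorm_map_measure]
  rfl

theorem isOpen_rightHalfPlane : IsOpen rightHalfPlane :=
  isOpen_lt continuous_const Complex.continuous_re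

theorem add_mul_I_mem_rightHalfPlane {x : ℝ} (hx : 0 < x) (y : ℝ) :
    (x : ℂ) + (y : ℂ) * Complex.I ∈ rightHalfPlane := by
  simpa [rightHalfPlane] using hx

theorem continuous_comp_add_mul_I {Φ : ℂ → ℂ} (h : ContinuousOn Φ rightHalfPlane) {x : ℝ}
    (hx : 0 < x) : Continuous fun y : ℝ => Φ ((x : ℂ) + (y : ℂ) * Complex.I) :=
  h.comp_continuous (by fun_prop) fun y => add_mul_I_mem_rightHalfPlane hx y

theorem continuous_verticalLine {Φ : ℂ → ℂ} (h : ContinuousOn Φ rightHalfPlane) {x : ℝ}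
    (hx : 0 < x) : Continuous (verticalLine Φ x) :=
  (continuous_comp_add_mul_I h hx).comp (by fun_prop : Continuous fun y : ℝ => 2 * Real.pi * y)

/-- Vertical integrals of a function which is analytic on the right half-plane and uniformly
integrable on the lines of a strip are the same on both sides of the strip. -/
theorem integral_vertical_eq {S : ℂ → ℂ} (hS : DifferentiableOn ℂ S rightHalfPlane)
    {x₁ x₂ : ℝ} (h1 : 0 < x₁) (h12 : x₁ ≤ x₂) {C : ℝ≥0}
    (hC : ∀ x ∈ Icc x₁ x₂, ∫⁻ y : ℝ, ‖S ((x : ℂ) + (y : ℂ) * Complex.I)‖ₑ ≤ C) :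
    ∫ y : ℝ, S ((x₁ : ℂ) + (y : ℂ) * Complex.I) = ∫ y : ℝ, S ((x₂ : ℂ) + (y : ℂ) * Complex.I) := by
  have hpos : ∀ x ∈ Icc x₁ x₂, 0 < x := fun x hx => h1.trans_le hx.1
  have hint : ∀ x ∈ Icc x₁ x₂, Integrable fun y : ℝ => S ((x : ℂ) + (y : ℂ) * Complex.I) :=
    fun x hx => ⟨(continuous_comp_add_mul_I hS.continuousOn (hpos x hx)).aestronglyMeasurable,
      (hC x hx).trans_lt ENNReal.coe_lt_top⟩
  set V : ℝ → ℝ → ℂ := fun x T => ∫ y in (-T)..T, S ((x : ℂ) + (y : ℂ) * Complex.I)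
  have hV : ∀ x ∈ Icc x₁ x₂, Tendsto (V x) atTop
      (𝓝 (∫ y : ℝ, S ((x : ℂ) + (y : ℂ) * Complex.I))) := fun x hx =>
    intervalIntegral_tendsto_integral (hint x hx) tendsto_neg_atTop_atBot tendsto_id
  -- the horizontal sides
  set k : ℝ → ℝ≥0∞ := fun T => ∫⁻ x in Ioc x₁ x₂, ‖S ((x : ℂ) + (T : ℂ) * Complex.I)‖ₑ
  -- Tonelli's theorem needs a globally measurable integrand, and `S` is controlled only on the
  -- half-plane; hence the indicator.
  have hmeas : Measurable fun z : ℝ × ℝ =>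
      (rightHalfPlane.indicator S) ((z.2 : ℂ) + (z.1 : ℂ) * Complex.I) := by
    have : Measurable (rightHalfPlane.indicator S) := by
      classical
      rw [← piecewise_eq_indicator]
      exact ContinuousOn.measurable_piecewise hS.continuousOn
        (continuousOn_const (c := (0 : ℂ)) (s := rightHalfPlaneᶜ))
        isOpen_rightHalfPlane.measurableSet
    exact this.comp (by fun_prop)
  have hk' : ∀ T, k T = ∫⁻ x in Ioc x₁ x₂,
      ‖(rightHalfPlane.indicator S) ((x : ℂ) + (T : ℂ) * Complex.I)‖ₑ := fun T => by
    refine setLIntegral_congr_fun measurableSet_Ioc fun x hx => ?_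
    simp only [indicator_of_mem (add_mul_I_mem_rightHalfPlane (h1.trans hx.1) T)]
  have hkm : Measurable k := by
    simp_rw [funext hk']
    exact Measurable.lintegral_prod_right' (f := fun z : ℝ × ℝ =>
      ‖(rightHalfPlane.indicator S) ((z.2 : ℂ) + (z.1 : ℂ) * Complex.I)‖ₑ) hmeas.enorm
  have hkfin : ∫⁻ T, k T < ⊤ := by
    simp_rw [hk']
    rw [lintegral_lintegral_swap (f := fun T x : ℝ =>
      ‖(rightHalfPlane.indicator S) ((x : ℂ) + (T : ℂ) * Complex.I)‖ₑ) hmeas.enorm.aemeasurable]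
    calc _ ≤ ∫⁻ x in Ioc x₁ x₂, (C : ℝ≥0∞) := by
          refine setLIntegral_mono' measurableSet_Ioc fun x hx => ?_
          refine le_trans (le_of_eq ?_) (hC x ⟨hx.1.le, hx.2⟩)
          refine lintegral_congr fun y => ?_
          rw [indicator_of_mem (add_mul_I_mem_rightHalfPlane (h1.trans hx.1) y)]
      _ < ⊤ := by
          rw [setLIntegral_const]
          exact ENNReal.mul_lt_top ENNReal.coe_lt_top (by simp)
  -- Cauchy's theorem on the rectangle of height `2T`: the vertical sides differ by the horizontal
  -- ones.
  have hbound : ∀ T : ℝ, ‖V x₂ T - V x₁ T‖ₑ ≤ k T + k (-T) := fun T => by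
    have hrect := Complex.integral_boundary_rect_eq_zero_of_differentiableOn S
      ((x₁ : ℂ) + ((-T : ℝ) : ℂ) * Complex.I) ((x₂ : ℂ) + (T : ℂ) * Complex.I) (by
        refine hS.mono fun s hs => ?_
        have := hs.1
        simp [uIcc_of_le h12] at this
        exact h1.trans_le this.1)
    simp only [Complex.add_re, Complex.ofReal_re, Complex.mul_re, Complex.I_re, mul_zero,
      Complex.ofReal_im, Complex.I_im, mul_one, sub_self, add_zero, Complex.add_im,
      Complex.mul_im, zero_add, smul_eq_mul] at hrect
    have hV2 : V x₂ T - V x₁ T = Complex.I *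
        ((∫ x in x₁..x₂, S ((x : ℂ) + ((-T : ℝ) : ℂ) * Complex.I)) -
        ∫ x in x₁..x₂, S ((x : ℂ) + (T : ℂ) * Complex.I)) := by
      have hI := Complex.I_mul_I
      simp only [V]
      linear_combination (-Complex.I) * hrect +
        ((∫ y in (-T)..T, S ((x₂ : ℂ) + (y : ℂ) * Complex.I)) -
          ∫ y in (-T)..T, S ((x₁ : ℂ) + (y : ℂ) * Complex.I)) * hI
    have hside : ∀ T : ℝ, ‖∫ x in x₁..x₂, S ((x : ℂ) + (T : ℂ) * Complex.I)‖ₑ ≤ k T := fun T => by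
      rw [intervalIntegral.integral_of_le h12]
      exact enorm_integral_le_lintegral_enorm _
    rw [hV2, enorm_mul]
    have : ‖Complex.I‖ₑ = 1 := by simp [← ofReal_norm]
    rw [this, one_mul]
    refine enorm_sub_le.trans ?_
    rw [add_comm]
    exact add_le_add (hside T) (hside (-T))
  have hlim := (hV x₂ (right_mem_Icc.2 h12)).sub (hV x₁ (left_mem_Icc.2 h12))
  -- If the limits differed, `k T + k (-T)` would exceed a fixed `δ > 0` for all large `T`, although
  -- `k` is integrable.
  by_contra hne
  have hL : 0 < ‖(∫ y : ℝ, S ((x₂ : ℂ) + (y : ℂ) * Complex.I)) -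
      ∫ y : ℝ, S ((x₁ : ℂ) + (y : ℂ) * Complex.I)‖ₑ :=
    enorm_pos.2 (sub_ne_zero.2 (Ne.symm hne))
  obtain ⟨δ, hδ0, hδ⟩ := exists_between hL
  obtain ⟨T₀, hT₀⟩ := eventually_atTop.1 (hlim.enorm.eventually (lt_mem_nhds hδ))
  have hfin : ∫⁻ T, (k T + k (-T)) < ⊤ := by
    rw [lintegral_add_left hkm, lintegral_neg_eq_self]
    exact ENNReal.add_lt_top.2 ⟨hkfin, hkfin⟩
  have : ∫⁻ T in Ici T₀, δ ≤ ∫⁻ T, (k T + k (-T)) :=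
    (setLIntegral_mono' measurableSet_Ici fun T hT => (hT₀ T hT).le.trans (hbound T)).trans
      (setLIntegral_le_lintegral _ _)
  rw [setLIntegral_const, Real.volume_Ici, ENNReal.mul_top hδ0.ne'] at this
  exact absurd (this.trans_lt hfin) (lt_irrefl _)

theorem bromwich_eq_integral (Φ : ℂ → ℂ) (x t : ℝ) :
    bromwich Φ x t = ∫ y : ℝ, Complex.exp
      (((x : ℂ) + ((2 * Real.pi * y : ℝ) : ℂ) * Complex.I) * t) *
        Φ ((x : ℂ) + ((2 * Real.pi * y : ℝ) : ℂ) * Complex.I) := by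
  rw [bromwich, Real.fourierInv_eq', ← integral_const_mul]
  congr 1
  ext y
  rw [smul_eq_mul, ← mul_assoc, ← Complex.exp_add]
  congr 2
  push_cast
  simp
  ring

variable {H : ℂ → ℂ} {C : ℝ≥0}

theorem integrable_verticalLine (hH : DifferentiableOn ℂ H rightHalfPlane)
    (hC : ∀ x : ℝ, 0 < x → hardyMean 1 H x ≤ C) {x : ℝ} (hx : 0 < x) :
    Integrable (verticalLine H x) := by
  rw [← memLp_one_iff_integrable]
  refine ⟨(continuous_verticalLine hH.continuousOn hx).aestronglyMeasurable, ?_⟩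
  rw [← hardyMean_eq_eLpNorm_verticalLine]
  exact (hC x hx).trans_lt ENNReal.coe_lt_top

/-- Contour shift for `e^{st} H(s)`: on the strip the exponential is at most `e^{x₂|t|}`, so the
`H^1` bound controls all vertical lines at once. -/
theorem bromwich_eq_bromwich (hH : DifferentiableOn ℂ H rightHalfPlane)
    (hC : ∀ x : ℝ, 0 < x → hardyMean 1 H x ≤ C) {x₁ x₂ : ℝ} (h1 : 0 < x₁) (h2 : 0 < x₂) (t : ℝ) :
    bromwich H x₁ t = bromwich H x₂ t := by
  wlog h12 : x₁ ≤ x₂ generalizing x₁ x₂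
  · exact (this h2 h1 (le_of_not_ge h12)).symm
  set S : ℂ → ℂ := fun s => Complex.exp (s * t) * H s with hS
  have hSd : DifferentiableOn ℂ S rightHalfPlane :=
    (by fun_prop : Differentiable ℂ fun s : ℂ => Complex.exp (s * t)).differentiableOn.mul hH
  have hb : ∀ x, bromwich H x t =
      |(2 * Real.pi)⁻¹| • ∫ y : ℝ, S ((x : ℂ) + (y : ℂ) * Complex.I) := fun x => by
    rw [bromwich_eq_integral,
      ← Measure.integral_comp_mul_left (fun y : ℝ => S ((x : ℂ) + (y : ℂ) * Complex.I))]
  have h2p : ENNReal.ofReal (2 * Real.pi) * ENNReal.ofReal (1 / (2 * Real.pi)) = 1 := by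
    rw [← ENNReal.ofReal_mul (by positivity), mul_one_div_cancel (by positivity),
      ENNReal.ofReal_one]
  rw [hb, hb, integral_vertical_eq hSd h1 h12
    (C := (Real.exp (x₂ * |t|)).toNNReal * ((2 * Real.pi).toNNReal * C))]
  intro x hx
  have hx0 := h1.trans_le hx.1
  have hm := hC x hx0
  rw [hardyMean, eLpNorm_one_eq_lintegral_enorm, lintegral_smul_measure, smul_eq_mul] at hm
  calc ∫⁻ y : ℝ, ‖S ((x : ℂ) + (y : ℂ) * Complex.I)‖ₑ
      ≤ ∫⁻ y : ℝ, ENNReal.ofReal (Real.exp (x₂ * |t|)) *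
          ‖H ((x : ℂ) + (y : ℂ) * Complex.I)‖ₑ := by
        refine lintegral_mono fun y => ?_
        simp only [hS, enorm_mul]
        gcongr
        rw [← ofReal_norm, Complex.norm_exp]
        refine ENNReal.ofReal_le_ofReal (Real.exp_le_exp.2 ?_)
        simp only [Complex.mul_re, Complex.add_re, Complex.ofReal_re, Complex.I_re, mul_zero,
          Complex.ofReal_im, Complex.I_im, mul_one, sub_self, add_zero, sub_zero]
        exact (mul_le_mul_of_nonneg_left (le_abs_self t) hx0.le).trans
          (mul_le_mul_of_nonneg_right hx.2 (abs_nonneg t))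
    _ = ENNReal.ofReal (Real.exp (x₂ * |t|)) *
          ∫⁻ y : ℝ, ‖H ((x : ℂ) + (y : ℂ) * Complex.I)‖ₑ :=
        lintegral_const_mul' _ _ ENNReal.ofReal_ne_top
    _ = ENNReal.ofReal (Real.exp (x₂ * |t|)) * (ENNReal.ofReal (2 * Real.pi) *
          (ENNReal.ofReal (1 / (2 * Real.pi)) *
            ∫⁻ y : ℝ, ‖H ((x : ℂ) + (y : ℂ) * Complex.I)‖ₑ)) := by
        rw [← mul_assoc (ENNReal.ofReal (2 * Real.pi)), h2p, one_mul]
    _ ≤ ENNReal.ofReal (Real.exp (x₂ * |t|)) * (ENNReal.ofReal (2 * Real.pi) * C) := by gcongr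
    _ = _ := by push_cast; rfl

theorem norm_bromwich_le_integral (Φ : ℂ → ℂ) (x t : ℝ) :
    ‖bromwich Φ x t‖ ≤ Real.exp (x * t) * ∫ y, ‖verticalLine Φ x y‖ := by
  rw [bromwich, norm_mul, Complex.norm_exp, Complex.ofReal_re]
  gcongr
  rw [Real.fourierInv_eq_fourier_neg]
  exact norm_fourier_le_integral _ _

theorem norm_bromwich_le (hH : DifferentiableOn ℂ H rightHalfPlane)
    (hC : ∀ x : ℝ, 0 < x → hardyMean 1 H x ≤ C) {x : ℝ} (hx : 0 < x) (t : ℝ) :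
    ‖bromwich H x t‖ ≤ Real.exp (x * t) * C := by
  refine (norm_bromwich_le_integral H x t).trans ?_
  gcongr
  rw [integral_norm_eq_lintegral_enorm (integrable_verticalLine hH hC hx).aestronglyMeasurable]
  refine ENNReal.toReal_le_coe_of_le_coe ?_
  rw [← eLpNorm_one_eq_lintegral_enorm, ← hardyMean_eq_eLpNorm_verticalLine]
  exact hC x hx

/-- Moving the line to `x → +∞` multiplies a uniform bound by `e^{xt} → 0`. -/
theorem bromwich_of_neg (hH : DifferentiableOn ℂ H rightHalfPlane)
    (hC : ∀ x : ℝ, 0 < x → hardyMean 1 H x ≤ C) {x : ℝ} (hx : 0 < x) {t : ℝ} (ht : t < 0) :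
    bromwich H x t = 0 := by
  have hlim : Tendsto (fun z : ℝ => Real.exp (z * t) * C) atTop (𝓝 (0 * C)) :=
    (Real.tendsto_exp_atBot.comp (tendsto_id.atTop_mul_const_of_neg ht)).mul_const _
  rw [zero_mul] at hlim
  refine norm_le_zero_iff.1 (ge_of_tendsto hlim ?_)
  filter_upwards [eventually_gt_atTop 0] with z hz
  rw [bromwich_eq_bromwich hH hC hx hz]
  exact norm_bromwich_le hH hC hz t

/-- On the line through `s`, `e^{-t Re s}` times the Bromwich integral is an inverse Fourier
transform. It vanishes for `t < 0`, and for `t > 0` the bound on the line at `Re s / 2` makes it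
`O(e^{-t Re s / 2})`. It is therefore integrable, and Fourier inversion applies. -/
theorem laplace_bromwich (hH : DifferentiableOn ℂ H rightHalfPlane)
    (hC : ∀ x : ℝ, 0 < x → hardyMean 1 H x ≤ C) {x : ℝ} (hx : 0 < x) {s : ℂ}
    (hs : s ∈ rightHalfPlane) : laplace (bromwich H x) s = H s := by
  have ha : 0 < s.re := hs
  set F := verticalLine H s.re
  have hF : Integrable F := integrable_verticalLine hH hC ha
  have hFc : Continuous F := continuous_verticalLine hH.continuousOn ha
  have hb : ∀ t, bromwich H x t = Complex.exp ((s.re * t : ℝ) : ℂ) * 𝓕⁻ F t := fun t => by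
    rw [bromwich_eq_bromwich hH hC hx ha]; rfl
  have hinv : ∀ t, 𝓕⁻ F t = Complex.exp ((-(s.re * t) : ℝ) : ℂ) * bromwich H x t := fun t => by
    rw [hb, ← mul_assoc, ← Complex.exp_add]
    simp
  have hneg : ∀ t < 0, 𝓕⁻ F t = 0 := fun t ht => by
    rw [hinv, bromwich_of_neg hH hC hx ht, mul_zero]
  have hcont : Continuous (𝓕⁻ F) := by
    have : 𝓕⁻ F = fun t => 𝓕 F (-t) := funext fun t => Real.fourierInv_eq_fourier_neg F t
    rw [this]
    exact (continuous_fourier_of_integrable hF).comp continuous_neg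
  have hint : Integrable (𝓕⁻ F) := by
    rw [← integrableOn_univ, ← Iio_union_Ici (a := (0 : ℝ)), integrableOn_union]
    constructor
    · exact (integrableOn_zero (ε' := ℂ)).congr_fun (fun t ht => (hneg t ht).symm) measurableSet_Iio
    · rw [integrableOn_Ici_iff_integrableOn_Ioi]
      refine ((exp_neg_integrableOn_Ioi 0 (half_pos ha)).mul_const (C : ℝ)).mono'
        hcont.aestronglyMeasurable.restrict (ae_of_all _ fun t => ?_)
      rw [hinv, norm_mul, Complex.norm_exp, Complex.ofReal_re,
        bromwich_eq_bromwich hH hC hx (half_pos ha)]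
      refine (mul_le_mul_of_nonneg_left (norm_bromwich_le hH hC (half_pos ha) t)
        (Real.exp_pos _).le).trans (le_of_eq ?_)
      rw [← mul_assoc, ← Real.exp_add]
      congr 2
      ring
  have hint' : Integrable (𝓕 F) := by
    have : 𝓕 F = fun t => 𝓕⁻ F (-t) := by
      ext t
      rw [Real.fourierInv_eq_fourier_neg, neg_neg]
    rw [this]
    exact hint.comp_neg
  have hinvF := congrFun (hFc.fourier_fourierInv_eq hF hint') (s.im / (2 * Real.pi))
  have hFs : F (s.im / (2 * Real.pi)) = H s := by
    simp only [F, verticalLine]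
    rw [mul_div_cancel₀ _ (by positivity), Complex.re_add_im]
  rw [← hFs, ← hinvF, Real.fourier_eq', laplace, ← integral_Ici_eq_integral_Ioi]
  refine Eq.trans ?_ (setIntegral_eq_integral_of_forall_compl_eq_zero (s := Ici 0) ?_)
  · refine setIntegral_congr_fun measurableSet_Ici fun t _ => ?_
    simp only [hb, smul_eq_mul]
    rw [← mul_assoc, ← Complex.exp_add]
    congr 2
    have : (Real.pi : ℂ) ≠ 0 := by exact_mod_cast Real.pi_ne_zero
    simp
    field_simp
    linear_combination (t : ℂ) * Complex.re_add_im s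
  · intro t ht
    rw [hneg t (by simpa using ht), smul_zero]

end

end NonlocalIVP

/-! ### Analyticity and injectivity of the Laplace transform -/

namespace NonlocalIVP

open FourierTransform

noncomputable section

theorem memLp_of_integrable_of_norm_le_one {α : Type*} {_ : MeasurableSpace α} {μ : Measure α}
    {f : α → ℂ} (hf : Integrable f μ) (h1 : ∀ᵐ x ∂μ, ‖f x‖ ≤ 1) {q : ℝ≥0∞} (hq : 1 ≤ q) :
    MemLp f q μ := by
  rcases eq_or_ne q ⊤ with rfl | hqt
  · exact memLp_top_of_bound hf.aestronglyMeasurable 1 h1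
  refine ⟨hf.aestronglyMeasurable, ?_⟩
  rw [eLpNorm_lt_top_iff_lintegral_rpow_enorm_lt_top (zero_lt_one.trans_le hq).ne' hqt]
  refine lt_of_le_of_lt (lintegral_mono_ae ?_) hf.2
  filter_upwards [h1] with x hx
  have hx' : ‖f x‖ₑ ≤ 1 := by
    rw [← ofReal_norm]; exact ENNReal.ofReal_le_one.2 hx
  have hq1 : 1 ≤ q.toReal := by
    have := ENNReal.toReal_mono hqt hq
    simpa using this
  calc ‖f x‖ₑ ^ q.toReal ≤ ‖f x‖ₑ ^ (1 : ℝ) := ENNReal.rpow_le_rpow_of_exponent_ge hx' hq1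
    _ = ‖f x‖ₑ := ENNReal.rpow_one _

/-- Lebesgue measure on `(0, ∞)`. -/
abbrev volPos : Measure ℝ := (volume : Measure ℝ).restrict (Ioi 0)

theorem memLp_cexp_neg {b : ℝ} (hb : 0 < b) {r : ℝ≥0∞} (hr : 1 ≤ r) :
    MemLp (fun t : ℝ => Complex.exp (-(b * t : ℝ))) r volPos := by
  have hn : ∀ t : ℝ, ‖Complex.exp (-(b * t : ℝ))‖ = Real.exp (-b * t) := fun t => by
    rw [← Complex.ofReal_neg, Complex.norm_exp, Complex.ofReal_re, neg_mul]
  refine memLp_of_integrable_of_norm_le_one ?_ ?_ hr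
  · refine (exp_neg_integrableOn_Ioi 0 hb).mono'
      (by fun_prop : Continuous _).aestronglyMeasurable (ae_of_all _ fun t => (hn t).le)
  · refine (ae_restrict_iff' measurableSet_Ioi).2 (ae_of_all _ fun t ht => ?_)
    rw [hn, Real.exp_le_one_iff]
    have : 0 < t := ht
    nlinarith

theorem integrable_exp_neg_mul_norm {p q : ℝ≥0∞} [hpq : p.HolderConjugate q] {φ : ℝ → ℂ}
    (hφ : MemLp φ q volPos) {b : ℝ} (hb : 0 < b) :
    Integrable (fun t : ℝ => Real.exp (-(b * t)) * ‖φ t‖) volPos := by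
  have h := memLp_one_iff_integrable.1
    (MemLp.mul' (r := 1) hφ (memLp_cexp_neg hb (ENNReal.HolderConjugate.one_le p q)))
  refine h.norm.congr (ae_of_all _ fun t => ?_)
  simp only [norm_mul, ← Complex.ofReal_neg, Complex.norm_exp, Complex.ofReal_re]

theorem norm_cexp_neg_mul (s : ℂ) (t : ℝ) : ‖Complex.exp (-(s * t))‖ = Real.exp (-(s.re * t)) := by
  rw [Complex.norm_exp]
  simp

theorem integrable_laplace {p q : ℝ≥0∞} [p.HolderConjugate q] {φ : ℝ → ℂ}
    (hφ : MemLp φ q volPos) {s : ℂ} (hs : s ∈ rightHalfPlane) :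
    Integrable (fun t : ℝ => Complex.exp (-(s * t)) * φ t) volPos := by
  refine (integrable_exp_neg_mul_norm (p := p) hφ (b := s.re) hs).mono'
    ((by fun_prop : Continuous fun t : ℝ => Complex.exp (-(s * t))).aestronglyMeasurable.mul hφ.1)
    (ae_of_all _ fun t => ?_)
  rw [norm_mul, norm_cexp_neg_mul]

theorem laplace_congr {φ ψ : ℝ → ℂ} (h : φ =ᵐ[volPos] ψ) : laplace φ = laplace ψ := by
  ext s
  refine integral_congr_ae ?_
  filter_upwards [h] with t ht
  rw [ht]

/-- The Laplace transform of an `L^q` function is analytic on the right half-plane. -/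
theorem differentiableOn_laplace {p q : ℝ≥0∞} [p.HolderConjugate q] {φ : ℝ → ℂ}
    (hφ : MemLp φ q volPos) : DifferentiableOn ℂ (laplace φ) rightHalfPlane := by
  intro s₀ hs₀
  have ha : 0 < s₀.re := hs₀
  have hmeas : ∀ s : ℂ, AEStronglyMeasurable (fun t : ℝ => Complex.exp (-(s * t)) * φ t) volPos :=
    fun s => (by fun_prop : Continuous fun t : ℝ =>
      Complex.exp (-(s * t))).aestronglyMeasurable.mul hφ.1
  have hnhds : {s : ℂ | s₀.re / 2 < s.re} ∈ 𝓝 s₀ :=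
    (isOpen_lt continuous_const Complex.continuous_re).mem_nhds (by simp; linarith)
  refine (hasDerivAt_integral_of_dominated_loc_of_deriv_le (μ := volPos)
    (F := fun s t => Complex.exp (-(s * (t : ℂ))) * φ t)
    (F' := fun s t => (-(t : ℂ)) * (Complex.exp (-(s * (t : ℂ))) * φ t))
    (bound := fun t => 4 / s₀.re * (Real.exp (-(s₀.re / 4 * t)) * ‖φ t‖))
    hnhds (Eventually.of_forall hmeas) (integrable_laplace (p := p) hφ hs₀) ?_ ?_ ?_
    ?_).2.differentiableAt.differentiableWithinAt
  · exact (by fun_prop : Continuous fun t : ℝ => -(t : ℂ)).aestronglyMeasurable.mul (hmeas s₀)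
  · refine (ae_restrict_iff' measurableSet_Ioi).2 (ae_of_all _ fun t ht s hs => ?_)
    have ht : 0 < t := ht
    have hs : s₀.re / 2 < s.re := hs
    rw [norm_mul, norm_mul, norm_cexp_neg_mul, norm_neg, Complex.norm_real, Real.norm_eq_abs,
      abs_of_pos ht, ← mul_assoc, ← mul_assoc]
    refine mul_le_mul_of_nonneg_right ?_ (norm_nonneg _)
    -- The decay is split in two: one factor absorbs the `t` produced by differentiation, the other
    -- keeps `φ` integrable.
    have h1 : Real.exp (-(s.re * t)) ≤ Real.exp (-(s₀.re / 4 * t)) * Real.exp (-(s₀.re / 4 * t)) := by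
      rw [← Real.exp_add]
      refine Real.exp_le_exp.2 ?_
      nlinarith
    have h2 : t * Real.exp (-(s₀.re / 4 * t)) ≤ 4 / s₀.re := by
      rw [Real.exp_neg, ← div_eq_mul_inv, div_le_div_iff₀ (Real.exp_pos _) ha]
      have := Real.add_one_le_exp (s₀.re / 4 * t)
      linarith
    calc t * Real.exp (-(s.re * t))
        ≤ t * (Real.exp (-(s₀.re / 4 * t)) * Real.exp (-(s₀.re / 4 * t))) := by gcongr
      _ = (t * Real.exp (-(s₀.re / 4 * t))) * Real.exp (-(s₀.re / 4 * t)) := by ring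
      _ ≤ _ := by gcongr
  · exact (integrable_exp_neg_mul_norm (p := p) hφ (by positivity)).const_mul _
  · refine ae_of_all _ fun t s _ => ?_
    have h := ((((hasDerivAt_id s).mul_const (t : ℂ)).fun_neg).cexp).mul_const (φ t)
    refine h.congr_deriv ?_
    simp only [id]
    ring

/-- Injectivity of the Laplace transform on `L^q(0, ∞)`, `q ≥ 2`. -/
theorem ae_eq_zero_of_laplace_eq_zero {p q : ℝ≥0∞} [p.HolderConjugate q] (hq : 2 ≤ q)
    {φ : ℝ → ℂ} (hφ : MemLp φ q volPos) (h0 : ∀ s ∈ rightHalfPlane, laplace φ s = 0) :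
    φ =ᵐ[volPos] 0 := by
  set u : ℝ → ℂ := fun t => Complex.exp (-((1 : ℂ) * t)) * φ t with hu
  have h1 : Integrable u volPos := integrable_laplace (p := p) hφ (by simp [rightHalfPlane])
  have h2 : MemLp u 2 volPos := by
    have hle : q⁻¹ ≤ (2 : ℝ≥0∞)⁻¹ := ENNReal.inv_le_inv.2 hq
    -- Hölder exponent that brings `e^{-t} φ` from `L^q` to `L²`; it is `⊤` when `q = 2`.
    have hT : ((2 : ℝ≥0∞)⁻¹ - q⁻¹)⁻¹.HolderTriple q 2 :=
      ⟨by rw [inv_inv, tsub_add_cancel_of_le hle]⟩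
    have hr : 1 ≤ ((2 : ℝ≥0∞)⁻¹ - q⁻¹)⁻¹ := by
      rw [ENNReal.one_le_inv]
      exact tsub_le_self.trans (by simp)
    have := MemLp.mul' (r := 2) hφ (memLp_cexp_neg one_pos hr)
    refine this.ae_eq (ae_of_all _ fun t => ?_)
    simp [hu]
  set F : ℝ → ℂ := (Ioi (0 : ℝ)).indicator u with hF
  have hF1 : Integrable F := (integrable_indicator_iff measurableSet_Ioi).2 h1
  have hF2 : MemLp F 2 volume := (memLp_indicator_iff_restrict measurableSet_Ioi).2 h2
  -- The Fourier transform of `e^{-t} φ` at `ξ` is the Laplace transform of `φ` at `1 + 2πiξ`.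
  have hzero : 𝓕 F = 0 := by
    ext ξ
    have hs : (1 : ℂ) + 2 * Real.pi * ξ * Complex.I ∈ rightHalfPlane := by
      simp [rightHalfPlane]
    rw [Pi.zero_apply, ← h0 _ hs, Real.fourier_eq', laplace, ← integral_indicator measurableSet_Ioi]
    refine integral_congr_ae (ae_of_all _ fun t => ?_)
    by_cases ht : t ∈ Ioi (0 : ℝ)
    · simp only [hF, hu, indicator_of_mem ht, smul_eq_mul, ← mul_assoc, ← Complex.exp_add]
      congr 2
      simp
      ring
    · simp [hF, indicator_of_notMem ht]
  have hn := eLpNorm_fourier_two hF1 hF2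
  rw [hzero, eLpNorm_zero, eq_comm, eLpNorm_eq_zero_iff hF2.1 (by norm_num)] at hn
  have hn' := (ae_restrict_of_ae (s := Ioi 0) hn)
  filter_upwards [hn', ae_restrict_mem measurableSet_Ioi] with t ht ht0
  simp only [hF, hu, indicator_of_mem ht0, Pi.zero_apply, mul_eq_zero, Complex.exp_ne_zero,
    false_or] at ht
  exact ht

/-- Injectivity of the Laplace transform on `L^q(0, ∞)`, `q ≥ 2`. -/
theorem ae_eq_of_laplace_eq {p q : ℝ≥0∞} [p.HolderConjugate q] (hq : 2 ≤ q) {φ ψ : ℝ → ℂ}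
    (hφ : MemLp φ q volPos) (hψ : MemLp ψ q volPos)
    (h : ∀ s ∈ rightHalfPlane, laplace φ s = laplace ψ s) : φ =ᵐ[volPos] ψ := by
  have := ae_eq_zero_of_laplace_eq_zero (p := p) hq (hφ.sub hψ) fun s hs => by
    have hint := integral_sub (integrable_laplace (p := p) hφ hs)
      (integrable_laplace (p := p) hψ hs)
    simp only [← mul_sub] at hint
    rw [laplace]
    simp only [Pi.sub_apply]
    rw [hint]
    exact sub_eq_zero.2 (h s hs)
  filter_upwards [this] with t ht
  exact sub_eq_zero.1 ht

theorem laplace_add {p q : ℝ≥0∞} [p.HolderConjugate q] {φ ψ : ℝ → ℂ} (hφ : MemLp φ q volPos)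
    (hψ : MemLp ψ q volPos) {s : ℂ} (hs : s ∈ rightHalfPlane) :
    laplace (fun t => φ t + ψ t) s = laplace φ s + laplace ψ s := by
  simp only [laplace, mul_add]
  exact integral_add (integrable_laplace (p := p) hφ hs) (integrable_laplace (p := p) hψ hs)

theorem laplace_sum_const_mul {p q : ℝ≥0∞} [p.HolderConjugate q] {ι : Type*} (T : Finset ι)
    (a : ι → ℂ) {e : ι → ℝ → ℂ} (he : ∀ i, MemLp (e i) q volPos) {s : ℂ} (hs : s ∈ rightHalfPlane) :
    laplace (fun t => ∑ i ∈ T, a i * e i t) s = ∑ i ∈ T, a i * laplace (e i) s := by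
  simp only [laplace, Finset.mul_sum, ← integral_const_mul]
  rw [integral_finsetSum]
  · refine Finset.sum_congr rfl fun i _ => integral_congr_ae (ae_of_all _ fun t => ?_)
    ring
  · intro i _
    refine ((integrable_laplace (p := p) (he i) hs).const_mul (a i)).congr (ae_of_all _ fun t => ?_)
    ring

end

end NonlocalIVP

/-! ### From `H^1` to `H^p` by regularization -/

namespace NonlocalIVP

open FourierTransform

noncomputable section

/-- The analytic factor `(1 + ε s)⁻²`, which turns `H^p` functions into `H^1` functions. -/
def regularizer (ε : ℝ) (s : ℂ) : ℂ := ((1 + ε * s) ^ 2)⁻¹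

theorem one_le_norm_one_add_mul {ε : ℝ} (hε : 0 ≤ ε) {s : ℂ} (hs : s ∈ rightHalfPlane) :
    1 + (ε * s.im) ^ 2 ≤ ‖(1 + ε * s) ^ 2‖ := by
  have hs : 0 < s.re := hs
  rw [norm_pow, ← Complex.normSq_eq_norm_sq, Complex.normSq_apply]
  simp only [Complex.add_re, Complex.one_re, Complex.mul_re, Complex.ofReal_re, Complex.ofReal_im,
    zero_mul, sub_zero, Complex.add_im, Complex.one_im, Complex.mul_im, add_zero, zero_add]
  have : 0 ≤ ε * s.re := by positivity
  nlinarith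

theorem norm_regularizer_le {ε : ℝ} (hε : 0 ≤ ε) {s : ℂ} (hs : s ∈ rightHalfPlane) :
    ‖regularizer ε s‖ ≤ (1 + (ε * s.im) ^ 2)⁻¹ := by
  rw [regularizer, norm_inv]
  exact inv_anti₀ (by positivity) (one_le_norm_one_add_mul hε hs)

theorem norm_regularizer_le_one {ε : ℝ} (hε : 0 ≤ ε) {s : ℂ} (hs : s ∈ rightHalfPlane) :
    ‖regularizer ε s‖ ≤ 1 :=
  (norm_regularizer_le hε hs).trans (inv_le_one_of_one_le₀ (by nlinarith [sq_nonneg (ε * s.im)]))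

theorem differentiableOn_regularizer {ε : ℝ} (hε : 0 ≤ ε) :
    DifferentiableOn ℂ (regularizer ε) rightHalfPlane := by
  refine DifferentiableOn.inv (by fun_prop) fun s hs h => ?_
  have := one_le_norm_one_add_mul hε hs
  rw [h, norm_zero] at this
  nlinarith [sq_nonneg (ε * s.im)]

theorem tendsto_regularizer (s : ℂ) :
    Tendsto (fun n : ℕ => regularizer (1 / ((n : ℝ) + 1)) s) atTop (𝓝 1) := by
  have h : Tendsto (fun n : ℕ => ((1 / ((n : ℝ) + 1) : ℝ) : ℂ)) atTop (𝓝 0) := by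
    have := (Complex.continuous_ofReal.tendsto 0).comp
      (tendsto_one_div_add_atTop_nhds_zero_nat (𝕜 := ℝ))
    rwa [Complex.ofReal_zero] at this
  have h2 : Tendsto (fun n : ℕ => ((1 + ((1 / ((n : ℝ) + 1) : ℝ) : ℂ) * s) ^ 2)⁻¹) atTop
      (𝓝 ((1 + 0 * s) ^ 2)⁻¹) :=
    ((tendsto_const_nhds.add (h.mul_const s)).pow 2).inv₀ (by simp)
  simpa [regularizer] using h2

variable {p q : ℝ≥0∞} {G : ℂ → ℂ}

theorem bromwich_eq_fourier (G : ℂ → ℂ) (σ : ℝ) :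
    bromwich G σ = fun t => Complex.exp ((σ * t : ℝ) : ℂ) * 𝓕 (verticalLine G σ) (-t) := by
  ext t
  rw [bromwich, Real.fourierInv_eq_fourier_neg]

theorem continuous_bromwich {σ : ℝ} (hint : Integrable (verticalLine G σ)) :
    Continuous (bromwich G σ) := by
  rw [bromwich_eq_fourier]
  exact (by fun_prop : Continuous fun t : ℝ => Complex.exp ((σ * t : ℝ) : ℂ)).mul
    ((continuous_fourier_of_integrable hint).comp continuous_neg)

/-- On each vertical line the regularizer is dominated by the same function `(1 + (εy)²)⁻¹`, which
lies in `L^q`; Hölder's inequality gives a bound independent of the line. -/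
theorem exists_hardyMean_one_regularizer_le [hpq : p.HolderConjugate q]
    (hG : DifferentiableOn ℂ G rightHalfPlane) {M : ℝ≥0}
    (hM : ∀ x : ℝ, 0 < x → hardyMean p G x ≤ M) {ε : ℝ} (hε : 0 < ε) :
    ∃ C : ℝ≥0, ∀ x : ℝ, 0 < x → hardyMean 1 (fun s => regularizer ε s * G s) x ≤ C := by
  set w : ℝ → ℂ := fun y => (((1 + (ε * (2 * Real.pi * y)) ^ 2)⁻¹ : ℝ) : ℂ) with hw
  have hwn : ∀ y, ‖w y‖ = (1 + (ε * (2 * Real.pi * y)) ^ 2)⁻¹ := fun y => by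
    rw [hw, Complex.norm_real, Real.norm_eq_abs, abs_of_pos (by positivity)]
  have hwm : MemLp w q volume := by
    refine memLp_of_integrable_of_norm_le_one ?_ (ae_of_all _ fun y => ?_)
      (ENNReal.HolderConjugate.one_le q p)
    · have h := integrable_inv_one_add_sq.comp_mul_left' (R := ε * (2 * Real.pi)) (by positivity)
      have h' : Integrable fun y : ℝ => (1 + (ε * (2 * Real.pi * y)) ^ 2)⁻¹ := by
        simpa only [mul_assoc] using h
      exact h'.ofReal
    · rw [hwn]
      exact inv_le_one_of_one_le₀ (by nlinarith [sq_nonneg (ε * (2 * Real.pi * y))])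
  refine ⟨(eLpNorm w q volume).toNNReal * M, fun x hx => ?_⟩
  have hR := differentiableOn_regularizer hε.le
  rw [hardyMean_eq_eLpNorm_verticalLine, ENNReal.coe_mul,
    ENNReal.coe_toNNReal hwm.eLpNorm_ne_top]
  have hT : q.HolderTriple p 1 := hpq.symm
  have h1 := eLpNorm_smul_le_mul_eLpNorm (p := q) (q := p) (r := 1) (μ := volume)
    (continuous_verticalLine hG.continuousOn hx).aestronglyMeasurable
    (continuous_verticalLine hR.continuousOn hx).aestronglyMeasurable
  refine h1.trans (mul_le_mul' (eLpNorm_mono fun y => ?_) ?_)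
  · rw [hwn]
    refine (norm_regularizer_le hε.le (add_mul_I_mem_rightHalfPlane hx _)).trans (le_of_eq ?_)
    simp
  · rw [← hardyMean_eq_eLpNorm_verticalLine]
    exact hM x hx

theorem norm_verticalLine_regularizer_le {ε : ℝ} (hε : 0 ≤ ε) {x : ℝ} (hx : 0 < x) (y : ℝ) :
    ‖verticalLine (fun s => regularizer ε s * G s) x y‖ ≤ ‖verticalLine G x y‖ := by
  simp only [verticalLine, norm_mul]
  exact mul_le_of_le_one_left (norm_nonneg _)
    (norm_regularizer_le_one hε (add_mul_I_mem_rightHalfPlane hx _))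

theorem tendsto_bromwich_regularizer (hG : ContinuousOn G rightHalfPlane) {σ : ℝ} (hσ : 0 < σ)
    (hint : Integrable (verticalLine G σ)) (t : ℝ) :
    Tendsto (fun n : ℕ => bromwich (fun s => regularizer (1 / ((n : ℝ) + 1)) s * G s) σ t) atTop
      (𝓝 (bromwich G σ t)) := by
  refine Tendsto.const_mul _ ?_
  simp only [Real.fourierInv_eq']
  have hε : ∀ n : ℕ, (0 : ℝ) ≤ 1 / ((n : ℝ) + 1) := fun n => by positivity
  refine tendsto_integral_of_dominated_convergence (fun y => ‖verticalLine G σ y‖) (fun n => ?_)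
    hint.norm (fun n => ae_of_all _ fun y => ?_) (ae_of_all _ fun y => ?_)
  · exact ((by fun_prop : Continuous fun v : ℝ =>
      Complex.exp (↑(2 * Real.pi * inner ℝ v t) * Complex.I)).smul
      (continuous_verticalLine ((differentiableOn_regularizer (hε n)).continuousOn.mul hG)
        hσ)).aestronglyMeasurable
  · rw [norm_smul, Complex.norm_exp_ofReal_mul_I, one_mul]
    exact norm_verticalLine_regularizer_le (hε n) hσ y
  · refine Tendsto.const_smul ?_ _
    have := (tendsto_regularizer ((σ : ℂ) + ((2 * Real.pi * y : ℝ) : ℂ) * Complex.I)).mul_const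
      (verticalLine G σ y)
    rwa [one_mul] at this

/-- The inverse Laplace transform of an `H^p` function, `1 < p ≤ 2`, which is integrable on one
vertical line. -/
theorem bromwich_properties (hp : 1 < p) (hp2 : p ≤ 2) (hpq : 1 / p + 1 / q = 1)
    (hG : MemHardy p G) {σ : ℝ} (hσ : 0 < σ) (hint : Integrable (verticalLine G σ)) :
    (∀ t < 0, bromwich G σ t = 0) ∧ MemLp (bromwich G σ) q volume ∧
      ∀ s ∈ rightHalfPlane, laplace (bromwich G σ) s = G s := by
  have hconj : p.HolderConjugate q := ⟨by simpa using hpq⟩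
  obtain ⟨hGd, M, hM⟩ := hG
  set ε : ℕ → ℝ := fun n => 1 / ((n : ℝ) + 1)
  have hε : ∀ n, 0 < ε n := fun n => by positivity
  set Gn : ℕ → ℂ → ℂ := fun n s => regularizer (ε n) s * G s
  have hGn : ∀ n, DifferentiableOn ℂ (Gn n) rightHalfPlane := fun n =>
    (differentiableOn_regularizer (hε n).le).mul hGd
  choose C hC using fun n => exists_hardyMean_one_regularizer_le (q := q) hGd hM (hε n)
  have hlim : ∀ t, Tendsto (fun n => bromwich (Gn n) σ t) atTop (𝓝 (bromwich G σ t)) :=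
    tendsto_bromwich_regularizer hGd.continuousOn hσ hint
  have hneg : ∀ t < 0, bromwich G σ t = 0 := fun t ht =>
    tendsto_nhds_unique (hlim t) (by
      simp only [fun n => bromwich_of_neg (hGn n) (hC n) hσ ht]
      exact tendsto_const_nhds)
  have hcont : Continuous (bromwich G σ) := continuous_bromwich hint
  obtain ⟨B, hB⟩ := exists_eLpNorm_fourier_le hp hp2 hpq M
  have hLq : eLpNorm (bromwich G σ) q volume ≤ B := by
    -- The regularized function is read on the line `Re s = ε n`, which approaches the boundary. The
    -- weight `e^{ε n t}` then tends to `1`, so Fatou's lemma gives an `L^q` bound without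
    -- exponential loss.
    set F : ℕ → ℝ → ℂ := fun n => 𝓕 (verticalLine (Gn n) (ε n))
    have hFint : ∀ n, Integrable (verticalLine (Gn n) (ε n)) := fun n =>
      integrable_verticalLine (hGn n) (hC n) (hε n)
    have hFB : ∀ n, eLpNorm (F n) q volume ≤ B := fun n => by
      refine hB _ (hFint n) ((eLpNorm_mono fun y =>
        norm_verticalLine_regularizer_le (hε n).le (hε n) y).trans ?_)
      rw [← hardyMean_eq_eLpNorm_verticalLine]
      exact hM _ (hε n)
    have hFlim : ∀ t, Tendsto (fun n => F n t) atTop (𝓝 (bromwich G σ (-t))) := fun t => by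
      have h1 : ∀ n, F n t = Complex.exp ((ε n * t : ℝ) : ℂ) * bromwich (Gn n) σ (-t) :=
        fun n => by
          rw [← bromwich_eq_bromwich (hGn n) (hC n) (hε n) hσ, bromwich,
            Real.fourierInv_eq_fourier_neg, neg_neg, ← mul_assoc, ← Complex.exp_add]
          simp [F]
      simp only [h1]
      have h2 : Tendsto (fun n => Complex.exp ((ε n * t : ℝ) : ℂ)) atTop (𝓝 1) := by
        have h3 : Tendsto (fun n => ((ε n * t : ℝ) : ℂ)) atTop (𝓝 ((0 * t : ℝ) : ℂ)) :=
          (Complex.continuous_ofReal.tendsto _).comp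
            ((tendsto_one_div_add_atTop_nhds_zero_nat (𝕜 := ℝ)).mul_const t)
        have := h3.cexp
        simpa using this
      have := h2.mul (hlim (-t))
      rwa [one_mul] at this
    have hle := Lp.eLpNorm_lim_le_liminf_eLpNorm (p := q) (μ := volume)
      (fun n => (continuous_fourier_of_integrable (hFint n)).aestronglyMeasurable)
      (fun t => bromwich G σ (-t)) (ae_of_all _ hFlim)
    have hfin : atTop.liminf (fun n => eLpNorm (F n) q volume) ≤ B :=
      liminf_le_of_le (by isBoundedDefault) fun b hb => by
        obtain ⟨n, hn⟩ := hb.exists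
        exact hn.trans (hFB n)
    have hnegm := eLpNorm_comp_measurePreserving (p := q) hcont.aestronglyMeasurable
      (Measure.measurePreserving_neg (volume : Measure ℝ))
    rw [← hnegm]
    exact hle.trans hfin
  have hmem : MemLp (bromwich G σ) q volume :=
    ⟨hcont.aestronglyMeasurable, hLq.trans_lt ENNReal.coe_lt_top⟩
  refine ⟨hneg, hmem, ?_⟩
  -- To the right of `σ` the kernel beats the growth `e^{σt}` and dominated convergence applies. The
  -- identity theorem extends the equality to the half-plane.
  have hlap : ∀ s : ℂ, σ < s.re → laplace (bromwich G σ) s = G s := fun s hs => by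
    have hs0 : s ∈ rightHalfPlane := hσ.trans hs
    have h1 : Tendsto (fun n => laplace (bromwich (Gn n) σ) s) atTop (𝓝 (G s)) := by
      simp only [fun n => laplace_bromwich (hGn n) (hC n) hσ hs0]
      have := (tendsto_regularizer s).mul_const (G s)
      rwa [one_mul] at this
    refine tendsto_nhds_unique ?_ h1
    refine tendsto_integral_of_dominated_convergence
      (fun t => Real.exp (-(s.re - σ) * t) * ∫ y, ‖verticalLine G σ y‖) (fun n => ?_)
      ((exp_neg_integrableOn_Ioi 0 (sub_pos.2 hs)).mul_const _)
      (fun n => ae_of_all _ fun t => ?_) (ae_of_all _ fun t => (hlim t).const_mul _)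
    · have hc := continuous_bromwich (integrable_verticalLine (hGn n) (hC n) hσ)
      exact ((by fun_prop : Continuous fun t : ℝ => Complex.exp (-(s * t))).mul
        hc).aestronglyMeasurable
    · rw [norm_mul, norm_cexp_neg_mul]
      refine (mul_le_mul_of_nonneg_left (norm_bromwich_le_integral _ _ _)
        (Real.exp_pos _).le).trans ?_
      rw [← mul_assoc, ← Real.exp_add, show -(s.re * t) + σ * t = -(s.re - σ) * t by ring]
      refine mul_le_mul_of_nonneg_left ?_ (Real.exp_pos _).le
      exact integral_mono (integrable_verticalLine (hGn n) (hC n) hσ).norm hint.norm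
        fun y => norm_verticalLine_regularizer_le (hε n).le hσ y
  have hz : ((σ + 1 : ℝ) : ℂ) ∈ rightHalfPlane := by
    simp only [rightHalfPlane, mem_ofPred_eq, Complex.ofReal_re]
    linarith
  refine AnalyticOnNhd.eqOn_of_preconnected_of_eventuallyEq
    ((differentiableOn_laplace (p := p) (hmem.restrict (Ioi 0))).analyticOnNhd isOpen_rightHalfPlane)
    (hGd.analyticOnNhd isOpen_rightHalfPlane) (convex_halfSpace_re_gt 0).isPreconnected hz ?_
  filter_upwards [(isOpen_lt continuous_const Complex.continuous_re).mem_nhds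
    (show σ < ((σ + 1 : ℝ) : ℂ).re by simp)] with s hs
  exact hlap s hs

theorem contDiff_bromwich {σ : ℝ} {K : ℕ}
    (hint : ∀ n : ℕ, n ≤ K →
      Integrable (fun y : ℝ => (y : ℂ) ^ n * G ((σ : ℂ) + (y : ℂ) * Complex.I))) :
    ContDiff ℝ K (bromwich G σ) := by
  have hF : ContDiff ℝ K (𝓕 (verticalLine G σ)) := by
    refine Real.contDiff_fourier (N := (K : ℕ∞)) fun n hn => ?_
    have h := ((hint n (by exact_mod_cast hn)).norm.comp_mul_left' (R := 2 * Real.pi)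
      (by positivity)).const_mul (((2 * Real.pi) ^ n)⁻¹)
    refine h.congr (ae_of_all _ fun y => ?_)
    simp only [norm_mul, norm_pow, Complex.norm_real, verticalLine]
    rw [Real.norm_of_nonneg zero_le_two, Real.norm_of_nonneg Real.pi_pos.le]
    field_simp
    rw [mul_pow]
    ring
  rw [bromwich_eq_fourier]
  have he : ContDiff ℝ K fun t : ℝ => Complex.exp ((σ * t : ℝ) : ℂ) :=
    (Complex.ofRealCLM.contDiff.comp (contDiff_const.mul contDiff_id)).cexp
  exact he.mul (hF.comp contDiff_neg)

theorem integrable_verticalLine_of_integrable {σ : ℝ}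
    (h : Integrable (fun y : ℝ => G ((σ : ℂ) + (y : ℂ) * Complex.I))) :
    Integrable (verticalLine G σ) :=
  h.comp_mul_left' (R := 2 * Real.pi) (by positivity)

/-- A `C^K` function which vanishes on the negative half-line is flat at the origin. -/
theorem iteratedDeriv_eq_zero_of_eq_zero_of_neg {g : ℝ → ℂ} {K : ℕ} (hg : ContDiff ℝ K g)
    (h0 : ∀ t < 0, g t = 0) {n : ℕ} (hn : n ≤ K) : iteratedDeriv n g 0 = 0 := by
  have hc : Continuous (iteratedDeriv n g) := hg.continuous_iteratedDeriv n (by exact_mod_cast hn)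
  have hz : ∀ t < 0, iteratedDeriv n g t = 0 := fun t ht => by
    have : g =ᶠ[𝓝 t] fun _ => (0 : ℂ) := by
      filter_upwards [Iio_mem_nhds ht] with y hy using h0 y hy
    rw [this.iteratedDeriv_eq n]
    simp
  have hl : Tendsto (iteratedDeriv n g) (𝓝[<] 0) (𝓝 (iteratedDeriv n g 0)) :=
    hc.continuousAt.tendsto.mono_left nhdsWithin_le_nhds
  refine tendsto_nhds_unique hl ((tendsto_congr' ?_).2 tendsto_const_nhds)
  filter_upwards [self_mem_nhdsWithin] with t ht using hz t ht

end

end NonlocalIVP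

/-! ### Exponential monomials and the confluent Vandermonde matrix -/

namespace NonlocalIVP

noncomputable section

/-- The exponential monomial `t ↦ t^j / j! * e^{w t}`. -/
def expMonomial (j : ℕ) (w : ℂ) (t : ℝ) : ℂ :=
  (t : ℂ) ^ j / (j.factorial : ℂ) * Complex.exp (w * t)

theorem contDiff_expMonomial (j : ℕ) (w : ℂ) {n : ℕ∞} : ContDiff ℝ n (expMonomial j w) := by
  have h : ContDiff ℝ n fun t : ℝ => (t : ℂ) := Complex.ofRealCLM.contDiff
  exact ((h.pow j).div_const _).mul (contDiff_const.mul h).cexp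

theorem hasDerivAt_expMonomial_zero (w : ℂ) (t : ℝ) :
    HasDerivAt (expMonomial 0 w) (w * expMonomial 0 w t) t := by
  have h := (((Complex.ofRealCLM.hasDerivAt (x := t)).const_mul w).cexp)
  simp only [Complex.ofRealCLM_apply, Complex.ofReal_one] at h
  convert! h using 1
  · ext t; simp [expMonomial]
  · simp [expMonomial]; ring

theorem hasDerivAt_expMonomial_succ (j : ℕ) (w : ℂ) (t : ℝ) :
    HasDerivAt (expMonomial (j + 1) w) (expMonomial j w t + w * expMonomial (j + 1) w t) t := by
  have h0 := Complex.ofRealCLM.hasDerivAt (x := t)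
  have h := ((h0.fun_pow (j + 1)).div_const ((j + 1).factorial : ℂ)).mul (h0.const_mul w).cexp
  simp only [Complex.ofRealCLM_apply, Complex.ofReal_one] at h
  refine h.congr_deriv ?_
  simp only [expMonomial, Nat.factorial_succ]
  have h1 : ((j : ℂ) + 1) ≠ 0 := by exact_mod_cast Nat.succ_ne_zero j
  have h2 : (j.factorial : ℂ) ≠ 0 := by exact_mod_cast j.factorial_ne_zero
  push_cast
  field_simp

/-- The derivative of the monomial of index `j + 1` is the one of index `j` plus `w` times itself,
which is Pascal's rule at `t = 0`. These values are the entries of `initialMatrix`. -/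
theorem iteratedDeriv_expMonomial (n j : ℕ) (w : ℂ) :
    iteratedDeriv n (expMonomial j w) 0 = (n.choose j : ℂ) * w ^ (n - j) := by
  induction n generalizing j with
  | zero =>
    rw [iteratedDeriv_zero]
    rcases j with _ | j <;> simp [expMonomial]
  | succ n ih =>
    have hc : ∀ j, ContDiffAt ℝ n (expMonomial j w) 0 := fun j =>
      (contDiff_expMonomial j w (n := (n : ℕ∞))).contDiffAt
    rw [iteratedDeriv_succ']
    rcases j with _ | j
    · rw [show deriv (expMonomial 0 w) = fun t => w * expMonomial 0 w t from
        funext fun t => (hasDerivAt_expMonomial_zero w t).deriv, iteratedDeriv_const_mul_field, ih]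
      simp [pow_succ']
    · rw [show deriv (expMonomial (j + 1) w) =
          (fun t => expMonomial j w t) + fun t => w * expMonomial (j + 1) w t from
        funext fun t => (hasDerivAt_expMonomial_succ j w t).deriv,
        iteratedDeriv_add (hc j) (contDiffAt_const.mul (hc (j + 1))),
        iteratedDeriv_const_mul_field, ih, ih, Nat.choose_succ_succ, Nat.add_sub_add_right]
      rcases le_or_gt (j + 1) n with h | h
      · rw [show n - j = n - (j + 1) + 1 by omega]
        push_cast
        ring
      · rw [Nat.choose_eq_zero_of_lt h]
        simp

/-- Half of the exponential decay absorbs the power, by `x^j / j! ≤ e^x` with `x = -(Re w) t / 2`.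
-/
theorem norm_expMonomial_le (j : ℕ) {w : ℂ} (hw : w.re < 0) {t : ℝ} (ht : 0 ≤ t) :
    ‖expMonomial j w t‖ ≤ (2 / -w.re) ^ j * Real.exp (-(-w.re / 2 * t)) := by
  have hb : 0 < -w.re := neg_pos.2 hw
  have h1 := Real.pow_div_factorial_le_exp (-w.re / 2 * t) (by positivity) j
  have h2 : ‖expMonomial j w t‖ = t ^ j / j.factorial * Real.exp (w.re * t) := by
    rw [expMonomial, norm_mul, norm_div, norm_pow, Complex.norm_exp, Complex.norm_natCast,
      Complex.norm_real, Real.norm_of_nonneg ht]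
    simp
  have h3 : t ^ j / j.factorial = (2 / -w.re) ^ j * ((-w.re / 2 * t) ^ j / j.factorial) := by
    rw [← mul_div_assoc, ← mul_pow]
    congr 2
    rw [← mul_assoc, div_mul_div_cancel₀ hb.ne', div_self two_ne_zero, one_mul]
  rw [h2, h3, mul_assoc]
  refine mul_le_mul_of_nonneg_left ?_ (by positivity)
  refine (mul_le_mul_of_nonneg_right h1 (Real.exp_pos _).le).trans (le_of_eq ?_)
  rw [← Real.exp_add]
  congr 1
  ring

theorem memLp_expMonomial (j : ℕ) {w : ℂ} (hw : w.re < 0) {q : ℝ≥0∞} (hq : 1 ≤ q) :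
    MemLp (expMonomial j w) q volPos := by
  have hb : 0 < -w.re / 2 := by linarith
  refine MemLp.of_le_mul (c := (2 / -w.re) ^ j) (memLp_cexp_neg hb hq)
    (contDiff_expMonomial j w (n := 0)).continuous.aestronglyMeasurable ?_
  refine (ae_restrict_iff' measurableSet_Ioi).2 (ae_of_all _ fun t ht => ?_)
  refine (norm_expMonomial_le j hw (le_of_lt ht)).trans (le_of_eq ?_)
  rw [← Complex.ofReal_neg, Complex.norm_exp, Complex.ofReal_re]

theorem tendsto_expMonomial (j : ℕ) {w : ℂ} (hw : w.re < 0) :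
    Tendsto (expMonomial j w) atTop (𝓝 0) := by
  have hb : 0 < -w.re / 2 := by linarith
  have h : Tendsto (fun t : ℝ => (2 / -w.re) ^ j * Real.exp (-(-w.re / 2 * t))) atTop
      (𝓝 ((2 / -w.re) ^ j * 0)) :=
    (Real.tendsto_exp_neg_atTop_nhds_zero.comp (tendsto_id.const_mul_atTop hb)).const_mul _
  rw [mul_zero] at h
  refine squeeze_zero_norm' ?_ h
  filter_upwards [eventually_ge_atTop 0] with t ht using norm_expMonomial_le j hw ht

theorem laplace_deriv {p q : ℝ≥0∞} [p.HolderConjugate q] {φ φ' : ℝ → ℂ} (hφ : MemLp φ q volPos)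
    (hφ' : MemLp φ' q volPos) (hd : ∀ t, HasDerivAt φ (φ' t) t) (hlim : Tendsto φ atTop (𝓝 0))
    {s : ℂ} (hs : s ∈ rightHalfPlane) : laplace φ' s = s * laplace φ s - φ 0 := by
  have h1 := integrable_laplace (p := p) hφ hs
  have h2 := integrable_laplace (p := p) hφ' hs
  have hderiv : ∀ t : ℝ, HasDerivAt (fun t : ℝ => Complex.exp (-(s * t)) * φ t)
      (Complex.exp (-(s * t)) * φ' t - s * (Complex.exp (-(s * t)) * φ t)) t := fun t => by
    have h0 := Complex.ofRealCLM.hasDerivAt (x := t)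
    have h := ((h0.const_mul s).fun_neg.cexp).mul (hd t)
    simp only [Complex.ofRealCLM_apply, Complex.ofReal_one] at h
    refine h.congr_deriv ?_
    ring
  have htend : Tendsto (fun t : ℝ => Complex.exp (-(s * t)) * φ t) atTop (𝓝 0) := by
    rw [tendsto_zero_iff_norm_tendsto_zero] at hlim ⊢
    refine squeeze_zero' (Eventually.of_forall fun _ => norm_nonneg _) ?_ hlim
    filter_upwards [eventually_ge_atTop 0] with t ht
    rw [norm_mul, norm_cexp_neg_mul]
    refine mul_le_of_le_one_left (norm_nonneg _) (Real.exp_le_one_iff.2 ?_)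
    have hs : 0 < s.re := hs
    nlinarith
  have h3 := integral_Ioi_of_hasDerivAt_of_tendsto' (a := 0) (fun t _ => hderiv t)
    (h2.sub (h1.const_mul s)) htend
  rw [integral_sub h2 (h1.const_mul s), integral_const_mul] at h3
  simp only [Complex.ofReal_zero, mul_zero, neg_zero, Complex.exp_zero, one_mul, zero_sub] at h3
  rw [laplace, laplace]
  linear_combination h3

/-- Integration by parts turns the differential recursion into `(s - w) L(e_{j+1}) = L(e_j)`,
starting from `(s - w) L(e_0) = 1`. -/
theorem laplace_expMonomial (j : ℕ) {w : ℂ} (hw : w.re < 0) {s : ℂ} (hs : s ∈ rightHalfPlane) :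
    laplace (expMonomial j w) s = ((s - w) ^ (j + 1))⁻¹ := by
  have hs0 : 0 < s.re := hs
  have hne : s - w ≠ 0 := fun h => by
    have := congrArg Complex.re h
    simp at this
    linarith
  -- The exponent `2` is only a convenient choice: the Laplace integral does not depend on it.
  have hT : (2 : ℝ≥0∞).HolderConjugate 2 := ⟨by simp [ENNReal.inv_two_add_inv_two]⟩
  have hm : ∀ j, MemLp (expMonomial j w) 2 volPos := fun j => memLp_expMonomial j hw (by norm_num)
  induction j with
  | zero =>
    have h := laplace_deriv (p := 2) (hm 0) ((hm 0).const_mul w) (hasDerivAt_expMonomial_zero w)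
      (tendsto_expMonomial 0 hw) hs
    have h1 := laplace_sum_const_mul (p := 2) (Finset.univ : Finset Unit) (fun _ => w)
      (e := fun _ => expMonomial 0 w) (fun _ => hm 0) hs
    simp only [Finset.univ_unique, Finset.sum_singleton] at h1
    have h0 : expMonomial 0 w 0 = 1 := by simp [expMonomial]
    rw [h1, h0] at h
    rw [zero_add, pow_one]
    refine eq_inv_of_mul_eq_one_left ?_
    linear_combination -h
  | succ j ih =>
    have h := laplace_deriv (p := 2) (hm (j + 1)) ((hm j).add ((hm (j + 1)).const_mul w))
      (hasDerivAt_expMonomial_succ j w) (tendsto_expMonomial (j + 1) hw) hs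
    have h1 := laplace_sum_const_mul (p := 2) (Finset.univ : Finset Unit) (fun _ => w)
      (e := fun _ => expMonomial (j + 1) w) (fun _ => hm (j + 1)) hs
    simp only [Finset.univ_unique, Finset.sum_singleton] at h1
    have h2 := laplace_add (p := 2) (hm j) ((hm (j + 1)).const_mul w) hs
    have h0 : expMonomial (j + 1) w 0 = 0 := by simp [expMonomial]
    have h3 : laplace (expMonomial j w + fun t => w * expMonomial (j + 1) w t) s =
        laplace (expMonomial j w) s + w * laplace (expMonomial (j + 1) w) s := by
      rw [← h1, ← h2]
      rfl
    rw [h3, h0, ih] at h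
    rw [pow_succ, mul_inv, ← div_eq_mul_inv, eq_div_iff hne]
    linear_combination -h

theorem memHardy_inv_pow {p : ℝ≥0∞} (hp : 1 < p) (hpt : p ≠ ⊤) (j : ℕ) {w : ℂ} (hw : w.re < 0) :
    MemHardy p (fun s => ((s - w) ^ (j + 1))⁻¹) := by
  have hb : 0 < -w.re := neg_pos.2 hw
  have hre : ∀ s ∈ rightHalfPlane, -w.re ≤ ‖s - w‖ := fun s hs => by
    have hs : 0 < s.re := hs
    refine le_trans ?_ (Complex.re_le_norm (s - w))
    simp
    linarith
  constructor
  · refine DifferentiableOn.inv (by fun_prop) fun s hs => pow_ne_zero _ ?_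
    exact norm_pos_iff.1 (hb.trans_le (hre s hs))
  -- Chosen so that `1 + |y| ≤ D ‖s - w‖`. One factor of the inverse power then decays like `1/(1 +
  -- |y|)`, which is `p`-integrable as `p > 1`; the others are at most `1/(-Re w)`.
  set D : ℝ := (1 + |w.im|) / -w.re + 1 with hD
  have hDpos : 0 < D := by positivity
  have hp1 : 1 < p.toReal := by
    have := (ENNReal.toReal_lt_toReal ENNReal.one_ne_top hpt).2 hp
    simpa using this
  have hmem : MemLp (fun y : ℝ => (1 + ‖y‖)⁻¹) p
      (ENNReal.ofReal (1 / (2 * Real.pi)) • (volume : Measure ℝ)) := by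
    refine MemLp.smul_measure ?_ ENNReal.ofReal_ne_top
    have hcont : Continuous fun y : ℝ => (1 + ‖y‖)⁻¹ :=
      Continuous.inv₀ (by fun_prop) fun y => by positivity
    rw [← integrable_norm_rpow_iff hcont.aestronglyMeasurable (zero_lt_one.trans hp).ne' hpt]
    refine (integrable_one_add_norm (E := ℝ) (r := p.toReal) (by simpa using hp1)).congr
      (ae_of_all _ fun y => ?_)
    simp only [norm_inv]
    rw [Real.norm_of_nonneg (by positivity : 0 ≤ 1 + ‖y‖), Real.inv_rpow (by positivity),
      Real.rpow_neg (by positivity)]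
  have hmem' := hmem.const_mul ((-w.re)⁻¹ ^ j * D)
  refine ⟨(eLpNorm (fun y : ℝ => ((-w.re)⁻¹ ^ j * D) * (1 + ‖y‖)⁻¹) p
    (ENNReal.ofReal (1 / (2 * Real.pi)) • (volume : Measure ℝ))).toNNReal, fun x hx => ?_⟩
  rw [ENNReal.coe_toNNReal hmem'.eLpNorm_ne_top, hardyMean]
  refine eLpNorm_mono_real fun y => ?_
  set s : ℂ := (x : ℂ) + (y : ℂ) * Complex.I with hs
  have h1 := hre s (add_mul_I_mem_rightHalfPlane hx y)
  have hsw : 0 < ‖s - w‖ := hb.trans_le h1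
  have h2 : |y - w.im| ≤ ‖s - w‖ := by
    refine le_trans (le_of_eq ?_) (Complex.abs_im_le_norm (s - w))
    simp [hs]
  have h3 : 1 + ‖y‖ ≤ D * ‖s - w‖ := by
    have h4 : |y| ≤ |y - w.im| + |w.im| := by
      have := abs_add_le (y - w.im) w.im
      simpa using this
    have h5 : 1 + |w.im| ≤ (1 + |w.im|) / -w.re * ‖s - w‖ := by
      rw [div_mul_eq_mul_div, le_div_iff₀ hb]
      gcongr
    rw [Real.norm_eq_abs, hD, add_mul, one_mul]
    linarith
  rw [norm_inv, norm_pow, pow_succ, mul_inv, ← inv_pow, mul_assoc]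
  gcongr
  rw [← div_eq_mul_inv, inv_le_comm₀ hsw (by positivity), inv_div, div_le_iff₀ hDpos]
  linarith

theorem initialMatrix_apply {N : ℕ} (r : Fin N → ℕ) (w : Fin N → ℂ) (n : Fin (∑ i, r i))
    (i : Fin N) (j : Fin (r i)) : initialMatrix r w n (finSigmaFinEquiv ⟨i, j⟩) =
      ((n : ℕ).choose (j : ℕ) : ℂ) * w i ^ ((n : ℕ) - (j : ℕ)) := by
  have h : finSigmaFinEquiv.symm (finSigmaFinEquiv ⟨i, j⟩) = ⟨i, j⟩ :=
    finSigmaFinEquiv.symm_apply_apply _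
  simp only [initialMatrix, Matrix.of_apply]
  rw [h]

open Polynomial in
/-- The confluent Vandermonde determinant does not vanish at distinct nodes. -/
theorem det_initialMatrix_ne_zero {N : ℕ} (r : Fin N → ℕ) {w : Fin N → ℂ}
    (hw : Function.Injective w) : (initialMatrix r w).det ≠ 0 := by
  intro h
  obtain ⟨b, hb0, hb⟩ := Matrix.exists_vecMul_eq_zero_iff.2 h
  apply hb0
  -- A left null vector is a polynomial of degree below `K`. Column `(i, j)` says that its `j`-th
  -- Hasse derivative vanishes at `w i`, so a monic polynomial of degree `K` divides it.
  set Q : ℂ[X] := ∑ n : Fin (∑ i, r i), monomial (n : ℕ) (b n) with hQ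
  have hcoeff : ∀ n : Fin (∑ i, r i), Q.coeff n = b n := fun n => by
    simp [hQ, coeff_monomial, Fin.val_inj]
  have hdvd : ∀ i, (X - C (w i)) ^ r i ∣ Q := fun i => by
    rw [X_sub_C_pow_dvd_iff, ← taylor_apply, X_pow_dvd_iff]
    intro j hj
    have hcol := congrFun hb (finSigmaFinEquiv ⟨i, ⟨j, hj⟩⟩)
    rw [taylor_coeff, hQ, map_sum, eval_finsetSum]
    rw [← show _ = (0 : ℂ) from hcol]
    simp only [Matrix.vecMul, dotProduct, initialMatrix_apply, hasseDeriv_monomial, eval_monomial]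
    refine Finset.sum_congr rfl fun n _ => ?_
    ring
  have hprod : ∏ i, (X - C (w i)) ^ r i ∣ Q :=
    Finset.prod_dvd_of_coprime (fun i _ j _ hij =>
      ((pairwise_coprime_X_sub_C hw hij).pow)) fun i _ => hdvd i
  have hmonic : (∏ i, (X - C (w i)) ^ r i).Monic :=
    monic_prod_of_monic _ _ fun i _ => (monic_X_sub_C _).pow _
  have hdeg : (∏ i, (X - C (w i)) ^ r i).natDegree = ∑ i, r i := by
    rw [natDegree_prod_of_monic _ _ fun i _ => (monic_X_sub_C _).pow _]
    simp
  have hQ0 : Q = 0 := by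
    refine eq_zero_of_dvd_of_degree_lt hprod ?_
    rw [degree_eq_natDegree hmonic.ne_zero, hdeg, hQ]
    refine (degree_sum_le _ _).trans_lt ((Finset.sup_lt_iff (WithBot.bot_lt_coe _)).2 fun n _ => ?_)
    exact (degree_monomial_le _ _).trans_lt (WithBot.coe_lt_coe.2 n.2)
  ext n
  rw [← hcoeff n, hQ0]
  simp

/-- A repeated node would give two equal columns with `j = 0`, which exist because every `r i` is
positive. -/
theorem injective_of_det_initialMatrix_ne_zero {N : ℕ} {r : Fin N → ℕ} (hr : ∀ i, 0 < r i)
    {w : Fin N → ℂ} (h : (initialMatrix r w).det ≠ 0) : Function.Injective w := by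
  intro i i' hii
  by_contra hne
  apply h
  refine Matrix.det_zero_of_column_eq (i := finSigmaFinEquiv ⟨i, ⟨0, hr i⟩⟩)
    (j := finSigmaFinEquiv ⟨i', ⟨0, hr i'⟩⟩) (fun he => hne ?_) fun n => ?_
  · have := finSigmaFinEquiv.injective he
    exact congrArg Sigma.fst this
  · simp [initialMatrix_apply, hii]

theorem exists_mvPolynomial_eval_eq_det {N : ℕ} (r : Fin N → ℕ) :
    ∃ Q : MvPolynomial (Fin N) ℂ, Q ≠ 0 ∧
      ∀ w : Fin N → ℂ, MvPolynomial.eval w Q = (initialMatrix r w).det := by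
  set B : Matrix (Fin (∑ i, r i)) (Fin (∑ i, r i)) (MvPolynomial (Fin N) ℂ) :=
    Matrix.of fun n k =>
      let ij : (i : Fin N) × Fin (r i) := finSigmaFinEquiv.symm k
      MvPolynomial.C ((n : ℕ).choose (ij.2 : ℕ) : ℂ) *
        MvPolynomial.X ij.1 ^ ((n : ℕ) - (ij.2 : ℕ))
  have hB : ∀ w : Fin N → ℂ, MvPolynomial.eval w B.det = (initialMatrix r w).det := fun w => by
    rw [RingHom.map_det]
    congr 1
    ext n k
    simp [B, initialMatrix]
  refine ⟨B.det, fun h0 => ?_, hB⟩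
  -- Any distinct nodes show that the polynomial is nonzero; `0, …, N - 1` are taken.
  have h := hB fun i => ((i : ℕ) : ℂ)
  rw [h0, map_zero] at h
  exact det_initialMatrix_ne_zero r (fun i j hij => Fin.ext (by exact_mod_cast hij)) h.symm

open Matrix in
/-- Off a proper algebraic subset, no coordinate of `A⁻¹ c` vanishes. -/
theorem exists_mvPolynomial_mulVec_ne_zero {m : ℕ} {A : Matrix (Fin m) (Fin m) ℂ}
    (hA : A.det ≠ 0) : ∃ P : MvPolynomial (Fin m) ℂ, P ≠ 0 ∧
      ∀ c, MvPolynomial.eval c P ≠ 0 → ∀ k, (A⁻¹ *ᵥ c) k ≠ 0 := by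
  set L : Fin m → MvPolynomial (Fin m) ℂ := fun k =>
    ∑ n, MvPolynomial.C (A⁻¹ k n) * MvPolynomial.X n
  have hL : ∀ k c, MvPolynomial.eval c (L k) = (A⁻¹ *ᵥ c) k := fun k c => by
    simp [L, Matrix.mulVec, dotProduct]
  refine ⟨∏ k, L k, Finset.prod_ne_zero_iff.2 fun k _ h0 => ?_, fun c hc k => ?_⟩
  · have h := hL k (A *ᵥ Pi.single k 1)
    rw [h0, map_zero, Matrix.mulVec_mulVec, Matrix.nonsing_inv_mul A (isUnit_iff_ne_zero.2 hA),
      Matrix.one_mulVec, Pi.single_eq_same] at h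
    exact zero_ne_one h
  · rw [map_prod] at hc
    rw [← hL]
    exact Finset.prod_ne_zero_iff.1 hc k (Finset.mem_univ k)

end

end NonlocalIVP

/-! ### Hardy space closure properties, poles and partial fractions -/

namespace NonlocalIVP

noncomputable section

theorem MemHardy.add {p : ℝ≥0∞} (hp : 1 ≤ p) {Φ Ψ : ℂ → ℂ} (hΦ : MemHardy p Φ)
    (hΨ : MemHardy p Ψ) : MemHardy p (fun s => Φ s + Ψ s) := by
  obtain ⟨hΦd, C, hC⟩ := hΦ
  obtain ⟨hΨd, D, hD⟩ := hΨ
  refine ⟨hΦd.add hΨd, C + D, fun x hx => ?_⟩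
  rw [ENNReal.coe_add]
  exact (eLpNorm_add_le (continuous_comp_add_mul_I hΦd.continuousOn hx).aestronglyMeasurable
    (continuous_comp_add_mul_I hΨd.continuousOn hx).aestronglyMeasurable hp).trans
    (add_le_add (hC x hx) (hD x hx))

theorem MemHardy.const_mul {p : ℝ≥0∞} {Φ : ℂ → ℂ} (hΦ : MemHardy p Φ) (a : ℂ) :
    MemHardy p (fun s => a * Φ s) := by
  obtain ⟨hΦd, C, hC⟩ := hΦ
  refine ⟨hΦd.const_mul a, ‖a‖₊ * C, fun x hx => ?_⟩
  rw [ENNReal.coe_mul]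
  have h := eLpNorm_const_smul a (fun y : ℝ => Φ ((x : ℂ) + (y : ℂ) * Complex.I)) p
    (ENNReal.ofReal (1 / (2 * Real.pi)) • (volume : Measure ℝ))
  exact h.le.trans (mul_le_mul' le_rfl (hC x hx))

theorem MemHardy.sum {p : ℝ≥0∞} (hp : 1 ≤ p) {ι : Type*} (T : Finset ι) {Φ : ι → ℂ → ℂ}
    (hΦ : ∀ i ∈ T, MemHardy p (Φ i)) : MemHardy p (fun s => ∑ i ∈ T, Φ i s) := by
  classical
  induction T using Finset.induction_on with
  | empty =>
    refine ⟨by simp, 0, fun x _ => ?_⟩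
    simp only [Finset.sum_empty, hardyMean]
    exact (eLpNorm_zero' (μ := _)).le
  | insert i T hi ih =>
    simp only [Finset.sum_insert hi]
    exact (hΦ i (Finset.mem_insert_self _ _)).add hp
      (ih fun j hj => hΦ j (Finset.mem_insert_of_mem hj))

theorem MemHardy.congr {p : ℝ≥0∞} {Φ Ψ : ℂ → ℂ} (hΦ : MemHardy p Φ)
    (h : EqOn Φ Ψ rightHalfPlane) : MemHardy p Ψ := by
  obtain ⟨hΦd, C, hC⟩ := hΦ
  refine ⟨hΦd.congr fun s hs => (h hs).symm, C, fun x hx => ?_⟩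
  refine le_trans (le_of_eq ?_) (hC x hx)
  simp only [hardyMean]
  congr 1
  ext y
  exact (h (add_mul_I_mem_rightHalfPlane hx y)).symm

theorem le_meromorphicOrderAt_iff {f : ℂ → ℂ} {x : ℂ} (hf : MeromorphicAt f x) (r : ℕ) :
    ((-(r : ℤ) : ℤ) : WithTop ℤ) ≤ meromorphicOrderAt f x ↔
      ∃ g : ℂ → ℂ, AnalyticAt ℂ g x ∧ f =ᶠ[𝓝[≠] x] fun z => ((z - x) ^ r)⁻¹ * g z := by
  have hpow : MeromorphicAt (fun z : ℂ => (z - x) ^ r) x := by fun_prop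
  have hpo : meromorphicOrderAt (fun z : ℂ => (z - x) ^ r) x = ((r : ℤ) : WithTop ℤ) := by
    exact_mod_cast fun_meromorphicOrderAt_pow_id_sub_const (x := x) (n := r)
  constructor
  · intro h
    have hmul := fun_meromorphicOrderAt_mul hpow hf
    have h0 : 0 ≤ meromorphicOrderAt (fun z => (z - x) ^ r * f z) x := by
      rw [hmul, hpo]
      calc (0 : WithTop ℤ) = ((r : ℤ) : WithTop ℤ) + ((-(r : ℤ) : ℤ) : WithTop ℤ) := by
            rw [← WithTop.coe_add, add_neg_cancel, WithTop.coe_zero]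
        _ ≤ _ := by gcongr
    obtain ⟨g, hg, hfg⟩ := (MeromorphicAt.meromorphicOrderAt_nonneg_iff (hpow.fun_mul hf)).1 h0
    refine ⟨g, hg, ?_⟩
    filter_upwards [hfg, self_mem_nhdsWithin] with z hz hzx
    rw [← hz, inv_mul_cancel_left₀ (pow_ne_zero _ (sub_ne_zero.2 hzx))]
  · rintro ⟨g, hg, hfg⟩
    rw [meromorphicOrderAt_congr hfg, fun_meromorphicOrderAt_mul hpow.fun_inv hg.meromorphicAt,
      fun_meromorphicOrderAt_inv, hpo]
    exact le_add_of_nonneg_right hg.meromorphicOrderAt_nonneg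

theorem meromorphicOrderAt_eq_neg {f g : ℂ → ℂ} {x : ℂ} {r : ℕ} (hg : AnalyticAt ℂ g x)
    (hgx : g x ≠ 0) (hfg : f =ᶠ[𝓝[≠] x] fun z => ((z - x) ^ r)⁻¹ * g z) :
    meromorphicOrderAt f x = ((-(r : ℤ) : ℤ) : WithTop ℤ) := by
  have hpow : MeromorphicAt (fun z : ℂ => (z - x) ^ r) x := by fun_prop
  rw [meromorphicOrderAt_congr hfg, meromorphicOrderAt_eq_int_iff
    (hpow.fun_inv.fun_mul hg.meromorphicAt)]
  exact ⟨g, hg, hgx, Eventually.of_forall fun z => by simp⟩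

/-- Writing `g z = g x + (z - x) * dslope g x z` splits off the pole term of highest order and
lowers `r` by one. -/
theorem AnalyticAt.exists_principalPart {g : ℂ → ℂ} {x : ℂ} (hg : AnalyticAt ℂ g x) (r : ℕ) :
    ∃ (a : ℕ → ℂ) (h : ℂ → ℂ), AnalyticAt ℂ h x ∧ ∀ z, z ≠ x →
      ((z - x) ^ r)⁻¹ * g z = ∑ j ∈ Finset.range r, a j * ((z - x) ^ (j + 1))⁻¹ + h z := by
  induction r generalizing g with
  | zero => exact ⟨0, g, hg, by simp⟩
  | succ r ih =>
    have hd : AnalyticAt ℂ (dslope g x) x := by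
      obtain ⟨s, hs, hgs⟩ := Complex.analyticAt_iff_eventually_differentiableAt.1 hg |>.exists_mem
      exact ((Complex.differentiableOn_dslope hs).2
        fun z hz => (hgs z hz).differentiableWithinAt).analyticAt hs
    obtain ⟨a, h, hh, hah⟩ := ih hd
    refine ⟨Function.update a r (g x), h, hh, fun z hz => ?_⟩
    have hzx : z - x ≠ 0 := sub_ne_zero.2 hz
    have hsum : ∑ j ∈ Finset.range r, Function.update a r (g x) j * ((z - x) ^ (j + 1))⁻¹ =
        ∑ j ∈ Finset.range r, a j * ((z - x) ^ (j + 1))⁻¹ := by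
      refine Finset.sum_congr rfl fun j hj => ?_
      rw [Function.update_of_ne (Finset.mem_range.1 hj).ne]
    rw [Finset.sum_range_succ, hsum, Function.update_self, add_right_comm, ← hah z hz,
      dslope_of_ne _ hz, slope_def_field, pow_succ]
    field_simp
    ring

variable {N : ℕ} {r : Fin N → ℕ} {w : Fin N → ℂ}

/-- The rational function `∑ a i j / (s - w i) ^ (j + 1)`. -/
def rationalPart (r : Fin N → ℕ) (w : Fin N → ℂ) (a : (i : Fin N) → Fin (r i) → ℂ) (s : ℂ) : ℂ :=
  ∑ i, ∑ j : Fin (r i), a i j * ((s - w i) ^ ((j : ℕ) + 1))⁻¹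

theorem analyticAt_inv_pow_sub {x s : ℂ} (h : s ≠ x) (n : ℕ) :
    AnalyticAt ℂ (fun z : ℂ => ((z - x) ^ n)⁻¹) s :=
  AnalyticAt.fun_inv (by fun_prop) (pow_ne_zero _ (sub_ne_zero.2 h))

theorem analyticAt_rationalPart (a : (i : Fin N) → Fin (r i) → ℂ) {s : ℂ} (hs : s ∉ range w) :
    AnalyticAt ℂ (rationalPart r w a) s :=
  Finset.analyticAt_fun_sum _ fun i _ => Finset.analyticAt_fun_sum _ fun _ _ =>
    analyticAt_const.fun_mul (analyticAt_inv_pow_sub (fun h => hs ⟨i, h.symm⟩) _)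

theorem meromorphicAt_rationalPart (a : (i : Fin N) → Fin (r i) → ℂ) (s : ℂ) :
    MeromorphicAt (rationalPart r w a) s :=
  MeromorphicAt.fun_sum fun i _ => MeromorphicAt.fun_sum fun _ _ => by fun_prop

theorem memHardy_rationalPart {p : ℝ≥0∞} (hp : 1 < p) (hpt : p ≠ ⊤) (hw : ∀ i, (w i).re < 0)
    (a : (i : Fin N) → Fin (r i) → ℂ) : MemHardy p (rationalPart r w a) :=
  MemHardy.sum hp.le _ fun i _ => MemHardy.sum hp.le _ fun j _ =>
    (memHardy_inv_pow hp hpt j (hw i)).const_mul (a i j)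

theorem rationalPart_isBigO (a : (i : Fin N) → Fin (r i) → ℂ) :
    rationalPart r w a =O[Bornology.cobounded ℂ] fun s => s⁻¹ := by
  refine Asymptotics.IsBigO.fun_sum fun i _ => Asymptotics.IsBigO.fun_sum fun j _ => ?_
  refine Asymptotics.IsBigO.const_mul_left ?_ _
  refine Asymptotics.IsBigO.of_bound 2 ?_
  filter_upwards [tendsto_norm_cobounded_atTop.eventually_ge_atTop (2 * (‖w i‖ + 1))] with s hs
  have h1 : ‖s‖ / 2 ≤ ‖s - w i‖ := by
    have := norm_sub_norm_le s (w i)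
    have := norm_nonneg (w i)
    linarith
  have hs0 : 0 < ‖s‖ := by
    have := norm_nonneg (w i)
    linarith
  have h2 : 1 ≤ ‖s - w i‖ := by
    have := norm_nonneg (w i)
    linarith
  rw [norm_inv, norm_inv, norm_pow]
  calc (‖s - w i‖ ^ ((j : ℕ) + 1))⁻¹ ≤ (‖s - w i‖)⁻¹ :=
        inv_anti₀ (by linarith) (le_self_pow₀ h2 (by omega))
    _ ≤ (‖s‖ / 2)⁻¹ := inv_anti₀ (by positivity) h1
    _ = 2 * ‖s‖⁻¹ := by rw [inv_div, div_eq_mul_inv]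

theorem decaysAtInfinity_rationalPart (a : (i : Fin N) → Fin (r i) → ℂ) :
    DecaysAtInfinity (rationalPart r w a) := by
  obtain ⟨C, hC⟩ := (rationalPart_isBigO (w := w) a).bound
  rw [← comap_norm_atTop, eventually_comap] at hC
  obtain ⟨B, hB⟩ := eventually_atTop.1 hC
  refine ⟨1, le_rfl, C, B, fun s hs => ?_⟩
  rw [Real.rpow_one, div_eq_mul_inv, ← norm_inv]
  exact hB _ hs s rfl

/-- The local form of `rationalPart` at one of its poles. -/
theorem exists_local_form_rationalPart (hinj : Function.Injective w) (hr : ∀ i, 0 < r i)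
    (a : (i : Fin N) → Fin (r i) → ℂ) (i : Fin N) :
    ∃ g : ℂ → ℂ, AnalyticAt ℂ g (w i) ∧ g (w i) = a i ⟨r i - 1, Nat.sub_lt (hr i) one_pos⟩ ∧
      rationalPart r w a =ᶠ[𝓝[≠] (w i)] fun z => ((z - w i) ^ r i)⁻¹ * g z := by
  classical
  -- This is `(z - w i)^(r i)` times the rational function, with the powers cancelled; at `w i` only
  -- `j = r i - 1` survives.
  refine ⟨fun z => (∑ j : Fin (r i), a i j * (z - w i) ^ (r i - 1 - j)) + (z - w i) ^ r i *
    ∑ i' ∈ Finset.univ.erase i, ∑ j : Fin (r i'), a i' j * ((z - w i') ^ ((j : ℕ) + 1))⁻¹,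
    ?_, ?_, ?_⟩
  · refine AnalyticAt.fun_add (Finset.analyticAt_fun_sum _ fun j _ => by fun_prop)
      (AnalyticAt.fun_mul (by fun_prop) (Finset.analyticAt_fun_sum _ fun i' hi' =>
        Finset.analyticAt_fun_sum _ fun j _ => analyticAt_const.fun_mul
          (analyticAt_inv_pow_sub (fun h => (Finset.ne_of_mem_erase hi') (hinj h).symm) _)))
  · simp only [sub_self, zero_pow (hr i).ne', zero_mul, add_zero]
    rw [Finset.sum_eq_single ⟨r i - 1, Nat.sub_lt (hr i) one_pos⟩]
    · simp
    · intro j _ hj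
      rw [zero_pow, mul_zero]
      intro h
      apply hj
      ext
      have := j.2
      simp only
      omega
    · simp
  · filter_upwards [self_mem_nhdsWithin] with z hz
    have hz : z - w i ≠ 0 := sub_ne_zero.2 hz
    rw [rationalPart, ← Finset.add_sum_erase _ _ (Finset.mem_univ i), mul_add,
      inv_mul_cancel_left₀ (pow_ne_zero _ hz), Finset.mul_sum]
    congr 1
    refine Finset.sum_congr rfl fun j _ => ?_
    have hj : r i = (r i - 1 - j) + ((j : ℕ) + 1) := by have := j.2; omega
    have hp : (z - w i) ^ r i = (z - w i) ^ (r i - 1 - j) * (z - w i) ^ ((j : ℕ) + 1) := by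
      rw [← pow_add, ← hj]
    rw [hp]
    field_simp

/-- A function which agrees near each point, off that point, with an analytic function extends to
an entire function. -/
theorem exists_differentiable_of_eventuallyEq {f : ℂ → ℂ}
    (h : ∀ x, ∃ g : ℂ → ℂ, AnalyticAt ℂ g x ∧ f =ᶠ[𝓝[≠] x] g) :
    ∃ F : ℂ → ℂ, Differentiable ℂ F ∧ ∀ x, ContinuousAt f x → F x = f x := by
  -- Punctured limits repair the values of `f` at all singular points at once, independently of the
  -- choice of local `g`.
  refine ⟨fun z => limUnder (𝓝[≠] z) f, fun x => ?_, fun x hx =>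
    (hx.tendsto.mono_left nhdsWithin_le_nhds).limUnder_eq⟩
  obtain ⟨g, hg, hfg⟩ := h x
  refine hg.differentiableAt.congr_of_eventuallyEq ?_
  have hev : ∀ᶠ z in 𝓝 x, f =ᶠ[𝓝[≠] z] g := by
    obtain ⟨U, hU, hUo, hxU⟩ := mem_nhds_iff.1 (mem_nhdsWithin_iff_eventually.1 hfg)
    filter_upwards [hUo.mem_nhds hxU] with z hz
    rcases eq_or_ne z x with rfl | hzx
    · exact hfg
    · have : U ∩ {x}ᶜ ∈ 𝓝 z :=
        inter_mem (hUo.mem_nhds hz) (isOpen_compl_singleton.mem_nhds hzx)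
      filter_upwards [mem_nhdsWithin_of_mem_nhds this] with y hy
      exact hU hy.1 hy.2
  filter_upwards [hev, hg.eventually_analyticAt] with z hz hgz
  exact ((hgz.continuousAt.tendsto.mono_left nhdsWithin_le_nhds).congr' hz.symm).limUnder_eq

theorem DecaysAtInfinity.tendsto_zero {R : ℂ → ℂ} (hR : DecaysAtInfinity R) :
    Tendsto R (Bornology.cobounded ℂ) (𝓝 0) := by
  obtain ⟨q, hq, C, B, hB⟩ := hR
  have h : Tendsto (fun s : ℂ => C / ‖s‖ ^ q) (Bornology.cobounded ℂ) (𝓝 0) :=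
    ((tendsto_rpow_atTop (by linarith)).comp tendsto_norm_cobounded_atTop).const_div_atTop C
  refine squeeze_zero_norm' ?_ h
  filter_upwards [tendsto_norm_cobounded_atTop.eventually_ge_atTop B] with s hs using hB s hs

/-- Partial fractions: a decaying function with finitely many poles of bounded order. -/
theorem exists_eq_rationalPart (hinj : Function.Injective w) {R : ℂ → ℂ}
    (hd : DifferentiableOn ℂ R (range w)ᶜ) (hm : ∀ i, MeromorphicAt R (w i))
    (ho : ∀ i, ((-(r i : ℤ) : ℤ) : WithTop ℤ) ≤ meromorphicOrderAt R (w i))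
    (hdec : DecaysAtInfinity R) :
    ∃ a : (i : Fin N) → Fin (r i) → ℂ, EqOn R (rationalPart r w a) (range w)ᶜ := by
  classical
  have hopen : IsOpen (range w)ᶜ := (finite_range w).isClosed.isOpen_compl
  have hloc : ∀ i, ∃ (a : ℕ → ℂ) (h : ℂ → ℂ), AnalyticAt ℂ h (w i) ∧ R =ᶠ[𝓝[≠] (w i)]
      fun z => ∑ j ∈ Finset.range (r i), a j * ((z - w i) ^ (j + 1))⁻¹ + h z := fun i => by
    obtain ⟨g, hg, hRg⟩ := (le_meromorphicOrderAt_iff (hm i) (r i)).1 (ho i)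
    obtain ⟨a, h, hh, hah⟩ := AnalyticAt.exists_principalPart hg (r i)
    refine ⟨a, h, hh, ?_⟩
    filter_upwards [hRg, self_mem_nhdsWithin] with z hz hzx
    rw [hz, hah z hzx]
  choose a h hh hR using hloc
  set b : (i : Fin N) → Fin (r i) → ℂ := fun i j => a i j
  refine ⟨b, ?_⟩
  have hRan : ∀ x ∉ range w, AnalyticAt ℂ R x := fun x hx => hd.analyticAt (hopen.mem_nhds hx)
  -- Removing all principal parts leaves an entire function that tends to zero at infinity, hence
  -- zero by Liouville.
  obtain ⟨F, hF, hFE⟩ := exists_differentiable_of_eventuallyEq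
    (f := fun z => R z - rationalPart r w b z) (fun x => by
      by_cases hx : x ∈ range w
      · obtain ⟨i, rfl⟩ := hx
        refine ⟨fun z => h i z - ∑ i' ∈ Finset.univ.erase i, ∑ j : Fin (r i'),
          b i' j * ((z - w i') ^ ((j : ℕ) + 1))⁻¹, (hh i).fun_sub
          (Finset.analyticAt_fun_sum _ fun i' hi' => Finset.analyticAt_fun_sum _ fun j _ =>
            analyticAt_const.fun_mul (analyticAt_inv_pow_sub
              (fun h => (Finset.ne_of_mem_erase hi') (hinj h).symm) _)), ?_⟩
        filter_upwards [hR i] with z hz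
        rw [hz, rationalPart, ← Finset.add_sum_erase _ _ (Finset.mem_univ i),
          Finset.sum_range fun j => a i j * ((z - w i) ^ (j + 1))⁻¹]
        simp only [b]
        ring
      · exact ⟨_, (hRan x hx).fun_sub (analyticAt_rationalPart b hx), EventuallyEq.rfl⟩)
  have hFeq : ∀ x ∉ range w, F x = R x - rationalPart r w b x := fun x hx =>
    hFE x ((hRan x hx).continuousAt.sub (analyticAt_rationalPart b hx).continuousAt)
  have hlim : Tendsto F (cocompact ℂ) (𝓝 0) := by
    rw [← Metric.cobounded_eq_cocompact]
    have h1 := hdec.tendsto_zero.sub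
      (decaysAtInfinity_rationalPart (w := w) b).tendsto_zero
    rw [sub_zero] at h1
    refine h1.congr' ?_
    have : (range w)ᶜ ∈ Bornology.cobounded ℂ :=
      Bornology.isBounded_def.1 (finite_range w).isBounded
    filter_upwards [this] with x hx using (hFeq x hx).symm
  intro x hx
  have := hF.apply_eq_of_tendsto_cocompact x hlim
  rw [hFeq x hx] at this
  exact sub_eq_zero.1 this

end

end NonlocalIVP

/-! ### The exponential part of the solution and its initial data -/

namespace NonlocalIVP

noncomputable section

variable {N : ℕ} {r : Fin N → ℕ} {w : Fin N → ℂ}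

/-- The inverse Laplace transform `∑ a i j * t^j / j! * e^{w i t}` of `rationalPart r w a`. -/
def expPart (r : Fin N → ℕ) (w : Fin N → ℂ) (a : (i : Fin N) → Fin (r i) → ℂ) (t : ℝ) : ℂ :=
  ∑ x : (i : Fin N) × Fin (r i), a x.1 x.2 * expMonomial x.2 (w x.1) t

theorem memLp_expPart (hw : ∀ i, (w i).re < 0) (a : (i : Fin N) → Fin (r i) → ℂ) {q : ℝ≥0∞}
    (hq : 1 ≤ q) : MemLp (expPart r w a) q volPos :=
  memLp_finsetSum _ fun x _ => (memLp_expMonomial x.2 (hw x.1) hq).const_mul _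

theorem contDiff_expPart (a : (i : Fin N) → Fin (r i) → ℂ) {n : ℕ∞} :
    ContDiff ℝ n (expPart r w a) :=
  ContDiff.sum fun _ _ => contDiff_const.mul (contDiff_expMonomial _ _)

theorem laplace_expPart (hw : ∀ i, (w i).re < 0) (a : (i : Fin N) → Fin (r i) → ℂ) {s : ℂ}
    (hs : s ∈ rightHalfPlane) : laplace (expPart r w a) s = rationalPart r w a s := by
  have hT : (2 : ℝ≥0∞).HolderConjugate 2 := ⟨by simp [ENNReal.inv_two_add_inv_two]⟩
  have h := laplace_sum_const_mul (p := 2)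
    (Finset.univ : Finset ((i : Fin N) × Fin (r i))) (fun x => a x.1 x.2)
    (e := fun x => expMonomial x.2 (w x.1))
    (fun x => memLp_expMonomial x.2 (hw x.1) (q := 2) (by norm_num)) hs
  refine h.trans ?_
  rw [Fintype.sum_sigma, rationalPart]
  refine Finset.sum_congr rfl fun i _ => Finset.sum_congr rfl fun j _ => ?_
  rw [laplace_expMonomial _ (hw i) hs]

theorem iteratedDeriv_sum_const_mul {ι : Type*} (T : Finset ι) (a : ι → ℂ) {e : ι → ℝ → ℂ} {n : ℕ}
    (he : ∀ i, ContDiff ℝ n (e i)) (t : ℝ) :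
    iteratedDeriv n (fun t => ∑ i ∈ T, a i * e i t) t = ∑ i ∈ T, a i * iteratedDeriv n (e i) t := by
  classical
  induction T using Finset.induction_on with
  | empty => simp
  | insert i T hi ih =>
    simp only [Finset.sum_insert hi]
    rw [iteratedDeriv_fun_add (contDiff_const.mul (he i)).contDiffAt
      (ContDiff.sum fun i _ => contDiff_const.mul (he i)).contDiffAt, ih,
      iteratedDeriv_const_mul_field]

theorem iteratedDeriv_expPart (a : (i : Fin N) → Fin (r i) → ℂ) (n : ℕ) (t : ℝ) :
    iteratedDeriv n (expPart r w a) t = ∑ x : (i : Fin N) × Fin (r i),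
      a x.1 x.2 * iteratedDeriv n (expMonomial x.2 (w x.1)) t :=
  iteratedDeriv_sum_const_mul _ _ (fun _ => contDiff_expMonomial _ _ (n := (n : ℕ∞))) t

/-- The coefficients `a i j`, listed in the order of the columns of `initialMatrix`. -/
def unflatten (v : Fin (∑ i, r i) → ℂ) (i : Fin N) (j : Fin (r i)) : ℂ :=
  v (finSigmaFinEquiv ⟨i, j⟩)

theorem exists_eq_unflatten (a : (i : Fin N) → Fin (r i) → ℂ) :
    ∃ v : Fin (∑ i, r i) → ℂ, a = unflatten v := by
  refine ⟨fun k => a (finSigmaFinEquiv.symm k).1 (finSigmaFinEquiv.symm k).2, ?_⟩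
  ext i j
  have h : finSigmaFinEquiv.symm (finSigmaFinEquiv ⟨i, j⟩) = ⟨i, j⟩ :=
    finSigmaFinEquiv.symm_apply_apply _
  rw [unflatten, h]

open Matrix in
theorem iteratedDeriv_expPart_zero (v : Fin (∑ i, r i) → ℂ) (n : Fin (∑ i, r i)) :
    iteratedDeriv n (expPart r w (unflatten v)) 0 = (initialMatrix r w *ᵥ v) n := by
  rw [iteratedDeriv_expPart, mulVec, dotProduct, ← Equiv.sum_comp finSigmaFinEquiv]
  refine Finset.sum_congr rfl fun x _ => ?_
  rw [initialMatrix_apply, iteratedDeriv_expMonomial, unflatten]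
  ring

theorem coeFn_sum_smul_toLp {ι : Type*} {q : ℝ≥0∞} (T : Finset ι) (a : ι → ℂ) {e : ι → ℝ → ℂ}
    (he : ∀ i, MemLp (e i) q volPos) :
    ((∑ i ∈ T, a i • (he i).toLp (e i) : LpHalfLine q) : ℝ → ℂ) =ᵐ[volPos]
      fun t => ∑ i ∈ T, a i * e i t := by
  classical
  induction T using Finset.induction_on with
  | empty =>
    simp only [Finset.sum_empty]
    exact Lp.coeFn_zero ..
  | insert i T hi ih =>
    simp only [Finset.sum_insert hi]
    filter_upwards [Lp.coeFn_add (a i • (he i).toLp (e i)) (∑ i ∈ T, a i • (he i).toLp (e i)),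
      Lp.coeFn_smul (a i) ((he i).toLp (e i)), (he i).coeFn_toLp, ih] with t h1 h2 h3 h4
    rw [h1, Pi.add_apply, h2, Pi.smul_apply, h3, h4, smul_eq_mul]

/-- This makes division by `f` legitimate despite its zeros: `f` can be cancelled near one point,
and the identity theorem does the rest. -/
theorem eqOn_of_mul_eqOn {f Φ Ψ : ℂ → ℂ} (hf : DifferentiableOn ℂ f rightHalfPlane)
    (hf0 : ∃ s ∈ rightHalfPlane, f s ≠ 0) (hΦ : DifferentiableOn ℂ Φ rightHalfPlane)
    (hΨ : DifferentiableOn ℂ Ψ rightHalfPlane)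
    (h : ∀ s ∈ rightHalfPlane, f s * Φ s = f s * Ψ s) : EqOn Φ Ψ rightHalfPlane := by
  obtain ⟨z, hz, hfz⟩ := hf0
  refine AnalyticOnNhd.eqOn_of_preconnected_of_eventuallyEq
    (hΦ.analyticOnNhd isOpen_rightHalfPlane) (hΨ.analyticOnNhd isOpen_rightHalfPlane)
    (convex_halfSpace_re_gt 0).isPreconnected hz ?_
  filter_upwards [isOpen_rightHalfPlane.mem_nhds hz,
    (hf.continuousOn.continuousAt (isOpen_rightHalfPlane.mem_nhds hz)).eventually_ne hfz]
    with s hs hfs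
  exact mul_left_cancel₀ hfs (h s hs)

/-- Almost everywhere equal functions, `C^K` up to the origin from the right, have the same
one-sided derivatives there. -/
theorem iteratedDerivWithin_congr_ae {g u : ℝ → ℂ} {K : ℕ}
    (hg : ContDiffWithinAt ℝ K g (Ici 0) 0) (hu : Continuous u) (h : g =ᵐ[volPos] u) (n : ℕ) :
    iteratedDerivWithin n g (Ici 0) 0 = iteratedDerivWithin n u (Ici 0) 0 := by
  -- Continuity near `0` suffices: functions continuous on `[0, ε)` and equal almost everywhere
  -- there are equal.
  obtain ⟨U, hUo, h0U, hgU⟩ := hg.contDiffOn' (m := 0) (by positivity) (by simp)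
  rw [insert_eq_of_mem self_mem_Ici] at hgU
  obtain ⟨ε, hε, hεU⟩ := Metric.isOpen_iff.1 hUo 0 h0U
  have hsub : Ico 0 ε ⊆ Ici 0 ∩ U := fun t ht =>
    ⟨ht.1, hεU (by rw [Metric.mem_ball, Real.dist_eq, sub_zero, abs_of_nonneg ht.1]; exact ht.2)⟩
  have hae : g =ᵐ[volume.restrict (Ico 0 ε)] u := by
    rw [← Measure.restrict_congr_set (Ioo_ae_eq_Ico (μ := volume) (a := (0 : ℝ)) (b := ε))]
    exact ae_mono (Measure.restrict_mono Ioo_subset_Ioi_self le_rfl) h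
  have heq : EqOn g u (Ico 0 ε) :=
    Measure.eqOn_of_ae_eq hae (hgU.continuousOn.mono hsub) hu.continuousOn (by
      rw [interior_Ico, closure_Ioo hε.ne]
      exact Ico_subset_Icc_self)
  refine Filter.EventuallyEq.iteratedDerivWithin_eq ?_ (heq ⟨le_rfl, hε⟩)
  filter_upwards [Ico_mem_nhdsGE hε] with t ht using heq ht

end

end NonlocalIVP

/-! ### Exact pole orders -/

namespace NonlocalIVP

noncomputable section

variable {N : ℕ} {r : Fin N → ℕ} {w : Fin N → ℂ}

theorem rightHalfPlane_subset_compl_range (hw : ∀ i, (w i).re < 0) :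
    rightHalfPlane ⊆ (range w)ᶜ := by
  rintro s hs ⟨i, rfl⟩
  exact lt_asymm hs (hw i)

theorem differentiableOn_rationalPart (a : (i : Fin N) → Fin (r i) → ℂ) :
    DifferentiableOn ℂ (rationalPart r w a) (range w)ᶜ := fun _ hs =>
  (analyticAt_rationalPart a hs).differentiableAt.differentiableWithinAt

/-- The complement of finitely many points is connected, so every continuation of the quotient
coincides there with `rationalPart`; its order at `w i` is read off the top coefficient. -/
theorem meromorphicOrderAt_of_isContinuedQuotient {f R : ℂ → ℂ}
    (hf : DifferentiableOn ℂ f rightHalfPlane) (hf0 : ∃ s ∈ rightHalfPlane, f s ≠ 0)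
    (hw : ∀ i, (w i).re < 0) (hinj : Function.Injective w) (hr : ∀ i, 0 < r i)
    {a : (i : Fin N) → Fin (r i) → ℂ} (ha : ∀ i j, a i j ≠ 0)
    (hR : IsContinuedQuotient w (fun s => f s * rationalPart r w a s) f R) (i : Fin N) :
    meromorphicOrderAt R (w i) = ((-(r i : ℤ) : ℤ) : WithTop ℤ) := by
  obtain ⟨hq, hd, -⟩ := hR
  have hsub := rightHalfPlane_subset_compl_range hw
  have hopen : IsOpen (range w)ᶜ := (finite_range w).isClosed.isOpen_compl
  have hz : (1 : ℂ) ∈ rightHalfPlane := by simp [rightHalfPlane]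
  have h1 := eqOn_of_mul_eqOn hf hf0 (hd.mono hsub)
    ((differentiableOn_rationalPart a).mono hsub) fun s hs => (hq s hs).symm
  have h2 : EqOn R (rationalPart r w a) (range w)ᶜ := by
    refine AnalyticOnNhd.eqOn_of_preconnected_of_eventuallyEq (hd.analyticOnNhd hopen)
      ((differentiableOn_rationalPart a).analyticOnNhd hopen)
      ((finite_range w).countable.isConnected_compl_of_one_lt_rank (by simp)).isPreconnected
      (hsub hz) ?_
    filter_upwards [isOpen_rightHalfPlane.mem_nhds hz] with s hs using h1 hs
  obtain ⟨g, hg, hgw, hRg⟩ := exists_local_form_rationalPart hinj hr a i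
  refine meromorphicOrderAt_eq_neg hg (by rw [hgw]; exact ha _ _) ?_
  have hpunct : (range w \ {w i})ᶜ ∈ 𝓝 (w i) :=
    ((finite_range w).subset sdiff_subset).isClosed.isOpen_compl.mem_nhds (by simp)
  filter_upwards [hRg, mem_nhdsWithin_of_mem_nhds hpunct, self_mem_nhdsWithin] with z hz hz1 hz2
  rw [← hz]
  exact h2 fun h => hz1 ⟨h, hz2⟩

end

end NonlocalIVP

/-! ### Existence, uniqueness and smooth dependence -/

theorem mainTheorem8 (p p' : ℝ≥0∞) [Fact (1 ≤ p')] (hp : 1 < p) (hp2 : p ≤ 2)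
    (hpp' : 1 / p + 1 / p' = 1)
    -- the symbol, analytic on the half-plane and not identically zero
    (f : ℂ → ℂ) (hf : DifferentiableOn ℂ f NonlocalIVP.rightHalfPlane)
    (hf0 : ∃ s ∈ NonlocalIVP.rightHalfPlane, f s ≠ 0)
    -- the source `J` with `L(J)` and `G = L(J) / f` in the Hardy space
    (J : NonlocalIVP.LpHalfLine p') (hJ : NonlocalIVP.MemHardy p (NonlocalIVP.laplace J))
    (G : ℂ → ℂ) (hG : NonlocalIVP.IsQuotient (NonlocalIVP.laplace J) f G)
    (hGp : NonlocalIVP.MemHardy p G)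
    -- the number of poles, their orders, and the integrability condition for `n ≤ K = ∑ r i`
    (N : ℕ) (r : Fin N → ℕ) (hr : ∀ i, 0 < r i)
    (hcond : ∃ σ : ℝ, 0 < σ ∧ ∀ n : ℕ, n ≤ ∑ i, r i →
      Integrable (fun y : ℝ => (y : ℂ) ^ n * G ((σ : ℂ) + (y : ℂ) * Complex.I))) :
    -- the exceptional set `{w | det = 0}` is a proper algebraic subset of `ℂ^N`
    (∃ Q : MvPolynomial (Fin N) ℂ, Q ≠ 0 ∧
      ∀ w : Fin N → ℂ, MvPolynomial.eval w Q = (NonlocalIVP.initialMatrix r w).det) ∧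
    -- off the exceptional set the problem is uniquely solvable, smoothly in the initial data
    ∀ w : Fin N → ℂ, (∀ i, (w i).re < 0) → (NonlocalIVP.initialMatrix r w).det ≠ 0 →
      ∃ (φ : (Fin (∑ i, r i) → ℂ) → NonlocalIVP.LpHalfLine p')
        (r₀ : (Fin (∑ i, r i) → ℂ) → ℂ → ℂ) (u : (Fin (∑ i, r i) → ℂ) → ℝ → ℂ),
        -- existence and uniqueness
        (∀ c, NonlocalIVP.IsClassicalSolution p f J w r c (φ c) (r₀ c)) ∧
        (∀ c ψ ρ, NonlocalIVP.IsClassicalSolution p f J w r c ψ ρ →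
          ψ = φ c ∧ EqOn ρ (r₀ c) NonlocalIVP.rightHalfPlane) ∧
        -- for all `c` off a proper algebraic subset, the poles have exactly the orders `r i`
        (∃ P : MvPolynomial (Fin (∑ i, r i)) ℂ, P ≠ 0 ∧
          ∀ c, MvPolynomial.eval c P ≠ 0 →
            ∀ R : ℂ → ℂ, NonlocalIVP.IsContinuedQuotient w (r₀ c) f R →
              ∀ i, meromorphicOrderAt R (w i) = ((-(r i : ℤ) : ℤ) : WithTop ℤ)) ∧
        -- the solution is of class `C^K` on `[0, ∞)` and satisfies the initial conditions
        (∀ c, (φ c =ᵐ[(volume : Measure ℝ).restrict (Ioi 0)] u c) ∧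
          ContDiffOn ℝ (∑ i, r i : ℕ) (u c) (Ici 0) ∧
          ∀ n : Fin (∑ i, r i), iteratedDerivWithin n (u c) (Ici 0) 0 = c n) ∧
        -- smooth dependence on the initial data: in `L^{p'}`, and pointwise for the derivatives
        -- in time up to order `K` and for `r₀`
        ContDiff ℝ ∞ φ ∧
        (∀ n : ℕ, n ≤ ∑ i, r i → ∀ t : ℝ, 0 ≤ t →
          ContDiff ℝ ∞ (fun c => iteratedDerivWithin n (u c) (Ici 0) t)) ∧
        (∀ s ∈ NonlocalIVP.rightHalfPlane, ContDiff ℝ ∞ (fun c => r₀ c s)) := by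
  refine ⟨NonlocalIVP.exists_mvPolynomial_eval_eq_det r, fun w hw hdet => ?_⟩
  have hconj : p.HolderConjugate p' := ⟨by simpa using hpp'⟩
  have hpt : p ≠ ⊤ := (hp2.trans_lt (by norm_num)).ne
  have hp1' : 1 ≤ p' := Fact.out
  have hp'2 : 2 ≤ p' := by
    have h1 : (2 : ℝ≥0∞)⁻¹ ≤ p⁻¹ := ENNReal.inv_le_inv.2 hp2
    have h2 : p⁻¹ + p'⁻¹ = 2⁻¹ + 2⁻¹ := by
      rw [ENNReal.inv_two_add_inv_two]
      simpa using hpp'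
    by_contra h
    have h3 : (2 : ℝ≥0∞)⁻¹ < p'⁻¹ := ENNReal.inv_lt_inv.2 (not_le.1 h)
    exact (ENNReal.add_lt_add_of_le_of_lt (by simp) h1 h3).ne h2.symm
  obtain ⟨σ, hσ, hint⟩ := hcond
  -- the inverse Laplace transform `g` of `G`
  set g : ℝ → ℂ := NonlocalIVP.bromwich G σ
  obtain ⟨hgneg, hgLp, hgL⟩ := NonlocalIVP.bromwich_properties hp hp2 hpp' hGp hσ
    (NonlocalIVP.integrable_verticalLine_of_integrable
      (by simpa using hint 0 (Nat.zero_le _)))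
  have hgC : ContDiff ℝ (∑ i, r i : ℕ) g := NonlocalIVP.contDiff_bromwich hint
  have hgL' : MemLp g p' NonlocalIVP.volPos := hgLp.restrict _
  have hinj := NonlocalIVP.injective_of_det_initialMatrix_ne_zero hr hdet
  set A := NonlocalIVP.initialMatrix r w
  have hAu : IsUnit A.det := isUnit_iff_ne_zero.2 hdet
  set a : (Fin (∑ i, r i) → ℂ) → (i : Fin N) → Fin (r i) → ℂ := fun c =>
    NonlocalIVP.unflatten (A⁻¹.mulVec c)
  have haC : ∀ i j, ContDiff ℝ ∞ fun c => a c i j := fun i j => by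
    simp only [a, NonlocalIVP.unflatten, Matrix.mulVec, dotProduct]
    fun_prop
  have he : ∀ x : (i : Fin N) × Fin (r i),
      MemLp (NonlocalIVP.expMonomial x.2 (w x.1)) p' NonlocalIVP.volPos := fun x =>
    NonlocalIVP.memLp_expMonomial _ (hw _) hp1'
  set u : (Fin (∑ i, r i) → ℂ) → ℝ → ℂ := fun c t => g t + NonlocalIVP.expPart r w (a c) t
  -- Built inside `L^{p'}` from fixed vectors with coefficients linear in `c`, so that smoothness in
  -- `c` is immediate.
  set φ : (Fin (∑ i, r i) → ℂ) → NonlocalIVP.LpHalfLine p' := fun c =>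
    hgL'.toLp g + ∑ x : (i : Fin N) × Fin (r i), a c x.1 x.2 • (he x).toLp _
  set r₀ : (Fin (∑ i, r i) → ℂ) → ℂ → ℂ := fun c s =>
    f s * NonlocalIVP.rationalPart r w (a c) s
  have hφu : ∀ c, φ c =ᵐ[NonlocalIVP.volPos] u c := fun c => by
    filter_upwards [Lp.coeFn_add (hgL'.toLp g)
      (∑ x : (i : Fin N) × Fin (r i), a c x.1 x.2 • (he x).toLp _), hgL'.coeFn_toLp,
      NonlocalIVP.coeFn_sum_smul_toLp Finset.univ
        (fun x : (i : Fin N) × Fin (r i) => a c x.1 x.2) he] with t h1 h2 h3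
    rw [h1, Pi.add_apply, h2, h3]
    rfl
  -- The coefficients `b` are arbitrary here because uniqueness uses this before they are known to
  -- equal `a c`.
  have hlapAux : ∀ b s, s ∈ NonlocalIVP.rightHalfPlane →
      NonlocalIVP.laplace (fun t => g t + NonlocalIVP.expPart r w b t) s =
        G s + NonlocalIVP.rationalPart r w b s := fun b s hs => by
    rw [NonlocalIVP.laplace_add (p := p) hgL' (NonlocalIVP.memLp_expPart hw b hp1') hs, hgL s hs,
      NonlocalIVP.laplace_expPart hw b hs]
  have hlap : ∀ c, ∀ s ∈ NonlocalIVP.rightHalfPlane, NonlocalIVP.laplace (φ c) s =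
      G s + NonlocalIVP.rationalPart r w (a c) s := fun c s hs => by
    rw [NonlocalIVP.laplace_congr (hφu c)]
    exact hlapAux (a c) s hs
  have huC' : ∀ b, ContDiff ℝ (∑ i, r i : ℕ)
      fun t => g t + NonlocalIVP.expPart r w b t := fun b =>
    hgC.add (NonlocalIVP.contDiff_expPart b (n := ((∑ i, r i : ℕ) : ℕ∞)))
  have huC : ∀ c, ContDiff ℝ (∑ i, r i : ℕ) (u c) := fun c => huC' (a c)
  have hwithin : ∀ b, ∀ n ≤ ∑ i, r i, ∀ t : ℝ, 0 ≤ t →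
      iteratedDerivWithin n (fun t => g t + NonlocalIVP.expPart r w b t) (Ici 0) t =
        iteratedDeriv n g t + iteratedDeriv n (NonlocalIVP.expPart r w b) t :=
    fun b n hn t ht => by
      have hn' : (n : WithTop ℕ∞) ≤ (∑ i, r i : ℕ) := by exact_mod_cast hn
      rw [iteratedDerivWithin_eq_iteratedDeriv (uniqueDiffOn_Ici 0)
        ((huC' b).of_le hn').contDiffAt ht, iteratedDeriv_fun_add (hgC.of_le hn').contDiffAt
        (NonlocalIVP.contDiff_expPart b (n := (n : ℕ∞))).contDiffAt]
  -- Since `g` is flat at `0`, only the exponential part contributes to the initial data.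
  have hinit' : ∀ (v : Fin (∑ i, r i) → ℂ) (n : Fin (∑ i, r i)),
      iteratedDerivWithin n (fun t => g t + NonlocalIVP.expPart r w (NonlocalIVP.unflatten v) t)
        (Ici 0) 0 = A.mulVec v n := fun v n => by
    rw [hwithin _ n n.2.le 0 le_rfl,
      NonlocalIVP.iteratedDeriv_eq_zero_of_eq_zero_of_neg hgC hgneg n.2.le, zero_add,
      NonlocalIVP.iteratedDeriv_expPart_zero]
  have hinit : ∀ c (n : Fin (∑ i, r i)), iteratedDerivWithin n (u c) (Ici 0) 0 = c n :=
    fun c n => by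
      rw [hinit', Matrix.mulVec_mulVec, Matrix.mul_nonsing_inv A hAu, Matrix.one_mulVec]
  have hsub := NonlocalIVP.rightHalfPlane_subset_compl_range hw
  have hrat : ∀ b, DifferentiableOn ℂ (NonlocalIVP.rationalPart r w b)
      NonlocalIVP.rightHalfPlane := fun b =>
    (NonlocalIVP.differentiableOn_rationalPart b).mono hsub
  refine ⟨φ, r₀, u, fun c => ?_, fun c ψ ρ hψ => ?_, ?_, fun c => ⟨hφu c, (huC c).contDiffOn,
    hinit c⟩, ?_, fun n hn t ht => ?_, fun s hs => ?_⟩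
  · have hdiff : ∀ s ∈ NonlocalIVP.rightHalfPlane,
        NonlocalIVP.laplace J s = f s * NonlocalIVP.laplace (φ c) s - r₀ c s := fun s hs => by
      rw [hlap c s hs, hG s hs]
      ring
    refine ⟨⟨⟨hf.mul (hrat _), hJ.congr hdiff⟩, hdiff⟩,
      ⟨u c, hφu c, (huC c).contDiffAt.contDiffWithinAt, hinit c⟩,
      ⟨NonlocalIVP.rationalPart r w (a c), ⟨fun _ _ => rfl,
        NonlocalIVP.differentiableOn_rationalPart _,
        fun i => NonlocalIVP.meromorphicAt_rationalPart _ _⟩,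
        NonlocalIVP.memHardy_rationalPart hp hpt hw _, fun i => ?_,
        NonlocalIVP.decaysAtInfinity_rationalPart _⟩,
      ⟨fun s => G s + NonlocalIVP.rationalPart r w (a c) s, fun s hs => ?_,
        hGp.add hp.le (NonlocalIVP.memHardy_rationalPart hp hpt hw _)⟩⟩
    · obtain ⟨h, hh, -, hloc⟩ := NonlocalIVP.exists_local_form_rationalPart hinj hr (a c) i
      exact (NonlocalIVP.le_meromorphicOrderAt_iff
        (NonlocalIVP.meromorphicAt_rationalPart _ _) _).2 ⟨h, hh, hloc⟩
    · simp only [r₀, hG s hs]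
      ring
  -- Uniqueness: partial fractions put any solution in the form `g` plus an exponential part, and
  -- the initial data then fix the coefficients through `A`.
  · obtain ⟨R, ⟨hRq, hRd, hRm⟩, -, hRo, hRdec⟩ := hψ.poles
    obtain ⟨b, hb⟩ := NonlocalIVP.exists_eq_rationalPart hinj hRd hRm hRo hRdec
    have hψL : MemLp ψ p' NonlocalIVP.volPos := Lp.memLp ψ
    have hLψ : EqOn (NonlocalIVP.laplace ψ) (fun s => G s + NonlocalIVP.rationalPart r w b s)
        NonlocalIVP.rightHalfPlane :=
      NonlocalIVP.eqOn_of_mul_eqOn hf hf0 (NonlocalIVP.differentiableOn_laplace (p := p) hψL)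
        (hGp.1.add (hrat b)) fun s hs => by
          have h1 := hψ.solves.2 s hs
          have h2 := hRq s hs
          rw [hb (hsub hs)] at h2
          rw [hG s hs] at h1
          linear_combination -h1 + h2
    have hψae : ψ =ᵐ[NonlocalIVP.volPos] fun t => g t + NonlocalIVP.expPart r w b t :=
      NonlocalIVP.ae_eq_of_laplace_eq (p := p) hp'2 hψL
        (hgL'.add (NonlocalIVP.memLp_expPart hw b hp1'))
        fun s hs => (hLψ hs).trans (hlapAux b s hs).symm
    obtain ⟨v, rfl⟩ := NonlocalIVP.exists_eq_unflatten b
    obtain ⟨h, hψh, hhC, hhc⟩ := hψ.initial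
    have hc : A.mulVec v = c := by
      ext n
      rw [← hhc n, ← hinit' v n]
      exact (NonlocalIVP.iteratedDerivWithin_congr_ae hhC (huC' _).continuous
        (hψh.symm.trans hψae) n).symm
    have hv : NonlocalIVP.unflatten v = a c := by
      simp only [a, ← hc, Matrix.mulVec_mulVec, Matrix.nonsing_inv_mul A hAu, Matrix.one_mulVec]
    rw [hv] at hψae hb
    refine ⟨Lp.ext (hψae.trans (hφu c).symm), fun s hs => ?_⟩
    rw [hRq s hs, hb (hsub hs)]
  · obtain ⟨P, hP0, hP⟩ := NonlocalIVP.exists_mvPolynomial_mulVec_ne_zero hdet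
    exact ⟨P, hP0, fun c hc R hR => NonlocalIVP.meromorphicOrderAt_of_isContinuedQuotient hf hf0
      hw hinj hr (fun i j => hP c hc _) hR⟩
  · exact contDiff_const.add (ContDiff.sum fun x _ => (haC x.1 x.2).smul contDiff_const)
  · simp only [u, fun c => hwithin (a c) n hn t ht, NonlocalIVP.iteratedDeriv_expPart]
    exact contDiff_const.add (ContDiff.sum fun x _ => (haC x.1 x.2).mul contDiff_const)
  · simp only [r₀, NonlocalIVP.rationalPart]
    exact contDiff_const.mul (ContDiff.sum fun i _ => ContDiff.sum fun j _ =>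
      (haC i j).mul contDiff_const)
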